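/- Let $\theta_1,\theta_2\in[0,2\pi)\setminus\{0,\pi/2,\pi,3\pi/2\}$, write $c_i=\cos\theta_i$, $s_i=\sin\theta_i$, and let $\alpha,\beta\in\mathbb C$ satisfy $|\alpha|^2+|\beta|^2=1$. Let $\{|x\rangle\otimes|j\rangle : x\in\{0,1,2,\ldots\},\ j\in\{0,1\}\}$ be the standard orthonormal basis of $\ell^2(\{0,1,2,\ldots\})\otimes\mathbb C^2$, let $C_i=c_i|0\rangle\langle0|+s_i|0\rangle\langle1|+s_i|1\rangle\langle0|-c_i|1\rangle\langle1|$, $\tilde C_i=\sum_{x\ge0}|x\rangle\langle x|\otimes C_i$ for $i=1,2$, and $$S=|0\rangle\langle0|\otimes|1\rangle\langle0|+\sum_{x\ge1}|x-1\rangle\langle x|\otimes|0\rangle\langle0|+\sum_{x\ge0}|x+1\rangle\langle x|\otimes|1\rangle\langle1|.$$ The 2-period quantum walk on the half line is given by $\Psi_0=|0\rangle\otimes(\alpha|0\rangle+\beta|1\rangle)$, $\Psi_{t+1}=S\tilde C_1\Psi_t$ for even $t$ and $\Psi_{t+1}=S\tilde C_2\Psi_t$ for odd $t$. The walker is at time $t$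 at position $x$ in the inner state $j$ with probability $\mathbb P(X_t=x;j)=\bigl|\bigl(\langle x|\otimes\langle j|\bigr)\Psi_t\bigr|^2$, and at position $x$ with probability $\mathbb P(X_t=x)=\mathbb P(X_t=x;0)+\mathbb P(X_t=x;1)$. Let $\xi\in\{1,2\}$ be an index with $|c_\xi|=\min\{|c_1|,|c_2|\}$, and let $I_{[0,|c_\xi|)}$ be the indicator function of $[0,|c_\xi|)$. Then for every real number $x$ $$\lim_{t\to\infty}\mathbb P\Bigl(\frac{X_t}{t}\le x;0\Bigr)=\int_{-\infty}^x\frac{|s_\xi|}{\pi(1+y)\sqrt{c_\xi^2-y^2}}\,I_{[0,|c_\xi|)}(y)\,dy,$$ $$\lim_{t\to\infty}\mathbb P\Bigl(\frac{X_t}{t}\le x;1\Bigr)=\int_{-\infty}^x\frac{|s_\xi|}{\pi(1-y)\sqrt{c_\xi^2-y^2}}\,I_{[0,|c_\xi|)}(y)\,dy,$$ $$\lim_{t\to\infty}\mathbb P\Bigl(\frac{X_t}{t}\le x\Bigr)=\int_{-\infty}^x\frac{2|s_\xi|}{\pi(1-y^2)\sqrt{c_\xi^2-y^2}}\,I_{[0,|c_\xi|)}(y)\,dy,$$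 where the three integrands are integrable on $\mathbb R$. In particular the limits do not depend on $\alpha,\beta$, and they depend on only one of the two coins. -/

import Mathlib

namespace HalfLineWalk

/-- A state of the walker on the half line: `φ x j` is the amplitude of `|x⟩ ⊗ |j⟩`, for a position
`x ∈ {0, 1, 2, …}` and an inner state `j ∈ {0, 1}`. -/
abbrev State : Type := ℕ → Fin 2 → ℂ

/-- The coin `cos θ |0⟩⟨0| + sin θ |0⟩⟨1| + sin θ |1⟩⟨0| - cos θ |1⟩⟨1|`. -/
noncomputable def coin (θ : ℝ) : Matrix (Fin 2) (Fin 2) ℂ :=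
  !![(Real.cos θ : ℂ), (Real.sin θ : ℂ); (Real.sin θ : ℂ), -(Real.cos θ : ℂ)]

/-- The coin operator `∑ₓ |x⟩⟨x| ⊗ C`. -/
noncomputable def coinStep (θ : ℝ) (φ : State) : State :=
  fun x => (coin θ).mulVec (φ x)

/-- The shift operator of the half line
`|0⟩⟨0| ⊗ |1⟩⟨0| + ∑_{x ≥ 1} |x-1⟩⟨x| ⊗ |0⟩⟨0| + ∑_{x ≥ 0} |x+1⟩⟨x| ⊗ |1⟩⟨1|`. -/
def shift (φ : State) : State
  | x, 0 => φ (x + 1) 0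
  | 0, 1 => φ 0 0
  | x + 1, 1 => φ x 1

/-- The initial state `|0⟩ ⊗ (α |0⟩ + β |1⟩)`. -/
def initial (α β : ℂ) : State
  | 0 => ![α, β]
  | _ + 1 => 0

/-- The state at time `t` of the 2-period walk: the coin with angle `θ 0` is used at the even
times `0, 2, 4, …`, the coin with angle `θ 1` at the odd times `1, 3, 5, …`. -/
noncomputable def state (θ : Fin 2 → ℝ) (α β : ℂ) : ℕ → State
  | 0 => initial α β
  | t + 1 => shift (coinStep (if Even t then θ 0 else θ 1) (state θ α β t))

/-- The probability `ℙ(X_t = x; j)` of finding the walker at time `t` at position `x` in the inner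
state `j`. -/
noncomputable def prob (θ : Fin 2 → ℝ) (α β : ℂ) (t x : ℕ) (j : Fin 2) : ℝ :=
  ‖state θ α β t x j‖ ^ 2

/-- The probability `ℙ(X_t = x)` of finding the walker at time `t` at position `x`. -/
noncomputable def totalProb (θ : Fin 2 → ℝ) (α β : ℂ) (t x : ℕ) : ℝ :=
  ∑ j : Fin 2, prob θ α β t x j

/-- `ℙ(X_t / t ≤ x; j)`. -/
noncomputable def rescaledCdf (θ : Fin 2 → ℝ) (α β : ℂ) (t : ℕ) (j : Fin 2) (x : ℝ) : ℝ :=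
  ∑' k : {k : ℕ | (k : ℝ) / (t : ℝ) ≤ x}, prob θ α β t k j

/-- `ℙ(X_t / t ≤ x)`. -/
noncomputable def rescaledTotalCdf (θ : Fin 2 → ℝ) (α β : ℂ) (t : ℕ) (x : ℝ) : ℝ :=
  ∑' k : {k : ℕ | (k : ℝ) / (t : ℝ) ≤ x}, totalProb θ α β t k

/-- At time `t` the walker is at one of the positions `0, …, t`; so the sums above are finite. -/
theorem state_eq_zero (θ : Fin 2 → ℝ) (α β : ℂ) (t : ℕ) :
    ∀ x, t < x → state θ α β t x = 0 := by
  induction t with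
  | zero =>
    intro x hx
    cases x with
    | zero => omega
    | succ x => rfl
  | succ t ih =>
    intro x hx
    have h : ∀ y, t < y → coinStep (if Even t then θ 0 else θ 1) (state θ α β t) y = 0 := by
      intro y hy
      simp [coinStep, ih y hy]
    cases x with
    | zero => omega
    | succ x =>
      funext j
      fin_cases j
      · exact congrFun (h (x + 1 + 1) (by omega)) 0
      · exact congrFun (h x (by omega)) 1

/-- The finding probabilities add up to `1`. -/
theorem hasSum_totalProb (θ : Fin 2 → ℝ) (α β : ℂ) (h : ‖α‖ ^ 2 + ‖β‖ ^ 2 = 1) (t : ℕ) :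
    HasSum (totalProb θ α β t) 1 := by
  have key : ∀ t, ∑ x ∈ Finset.range (t + 1), totalProb θ α β t x = 1 := by
    intro t
    induction t with
    | zero => simpa [totalProb, prob, state, initial] using h
    | succ t ih =>
      have hz := state_eq_zero θ α β t
      set a := if Even t then θ 0 else θ 1 with ha
      set u : ℕ → ℝ := fun x => ‖coinStep a (state θ α β t) x 0‖ ^ 2 with hu
      set v : ℕ → ℝ := fun x => ‖coinStep a (state θ α β t) x 1‖ ^ 2 with hv
      have h0 : ∀ x, prob θ α β (t + 1) x 0 = u (x + 1) := fun x => by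
        cases x <;> rfl
      have h1 : ∀ x, prob θ α β (t + 1) (x + 1) 1 = v x := fun x => rfl
      have h10 : prob θ α β (t + 1) 0 1 = u 0 := rfl
      have huz : ∀ x, t < x → u x = 0 := fun x hx => by simp [hu, coinStep, hz x hx]
      have huv : ∀ x, u x + v x = totalProb θ α β t x := fun x => by
        simp only [hu, hv, totalProb, prob, coinStep, coin, Fin.sum_univ_two, Matrix.mulVec,
          dotProduct, Matrix.of_apply, Matrix.cons_val_zero, Matrix.cons_val_one,
          ← Complex.normSq_eq_norm_sq, Complex.normSq_apply]
        simp [-Complex.ofReal_cos, -Complex.ofReal_sin]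
        linear_combination ((state θ α β t x 0).re ^ 2 + (state θ α β t x 0).im ^ 2
          + (state θ α β t x 1).re ^ 2 + (state θ α β t x 1).im ^ 2) * Real.sin_sq_add_cos_sq a
      have e0 : ∑ x ∈ Finset.range (t + 1 + 1), prob θ α β (t + 1) x 0 + u 0
          = ∑ x ∈ Finset.range (t + 1), u x := by
        simp_rw [h0]
        rw [← Finset.sum_range_succ' u, Finset.sum_range_succ, Finset.sum_range_succ,
          huz (t + 1 + 1) (by omega), huz (t + 1) (by omega)]
        ring
      have e1 : ∑ x ∈ Finset.range (t + 1 + 1), prob θ α β (t + 1) x 1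
          = ∑ x ∈ Finset.range (t + 1), v x + u 0 := by
        rw [Finset.sum_range_succ', h10]
        simp_rw [h1]
      have e2 : ∑ x ∈ Finset.range (t + 1), (u x + v x) = 1 := by
        simp_rw [huv]; exact ih
      rw [Finset.sum_add_distrib] at e2
      simp only [totalProb, Fin.sum_univ_two]
      rw [Finset.sum_add_distrib]
      linarith
  rw [← key t]
  refine hasSum_sum_of_ne_finset_zero fun x hx => ?_
  have hx' : t < x := by
    simp only [Finset.mem_range] at hx
    omega
  simp [totalProb, prob, state_eq_zero θ α β t x hx']

/-- The limit density for the inner state `0`, `|s| / (π (1 + y) √(c² - y²))` on `[0, |c|)` and `0`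
elsewhere, where `c = cos θ` and `s = sin θ`. -/
noncomputable def density₀ (θ : ℝ) : ℝ → ℝ :=
  (Set.Ico 0 |Real.cos θ|).indicator fun y =>
    |Real.sin θ| / (Real.pi * (1 + y) * Real.sqrt (Real.cos θ ^ 2 - y ^ 2))

/-- The limit density for the inner state `1`, `|s| / (π (1 - y) √(c² - y²))` on `[0, |c|)` and `0`
elsewhere. -/
noncomputable def density₁ (θ : ℝ) : ℝ → ℝ :=
  (Set.Ico 0 |Real.cos θ|).indicator fun y =>
    |Real.sin θ| / (Real.pi * (1 - y) * Real.sqrt (Real.cos θ ^ 2 - y ^ 2))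

/-- The limit density of the position, `2 |s| / (π (1 - y²) √(c² - y²))` on `[0, |c|)` and `0`
elsewhere. -/
noncomputable def densityTotal (θ : ℝ) : ℝ → ℝ :=
  (Set.Ico 0 |Real.cos θ|).indicator fun y =>
    2 * |Real.sin θ| / (Real.pi * (1 - y ^ 2) * Real.sqrt (Real.cos θ ^ 2 - y ^ 2))

end HalfLineWalk

namespace HalfLineWalk

open Complex Finset MeasureTheory ComplexConjugate Filter Topology

/-! The half line unfolds to ℤ: inner state 0 at `x` is attached to the sites `x`, `x + 1`, inner
state 1 to `-x`, `-x - 1`. The shift, reflection at the boundary included, becomes translation by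
one to the left, and the coin mixes a site with its mirror image. After multiplication by powers of
`I` the amplitudes are combinations of a real pair, `kernel`, which does not involve the initial
state (`state_eq_kernel`). By parity only one of the two attached sites contributes, and `α`, `β`
drop out once the contributions of a site to two neighbouring positions are added. So inner state 0
sees the law `weight` on the nonnegative sites and inner state 1 on the nonpositive ones, up to
boundary terms that vanish in the limit.

Reflection becomes conjugation on the Fourier side, so two steps act as one fixed unitary matrix and
`2 * n` steps as a rotation by `n ω(k)` about a fixed axis (`symbol_even`). By Parseval the
characteristic function of `X / t` is the mean over `k` of the overlap of the symbols at `k` and `k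
+ ζ / t`. The phases differ asymptotically by `-ζ v`, with `v` the group velocity, and the overlap
tends to `cos (ζ v) - I v sin (ζ v)` (`tendsto_overlap`).

This limit is even in `v`, so only the law of `|v|` for uniform `k` matters. The condition `y < |v|`
says that a cosine lies in an interval whose ends are, up to sign, cosines of the sum and difference
of two angles, one per coin. Its measure is `π` minus twice the larger angle, which belongs to the
coin with the smaller `|cos|`; hence only one coin survives (`measure_Ioo_inter_abs_cos_lt`,
`map_speed`). The factor `v` in the sine term splits the total density in the proportions `(1 - y) /
2` and `(1 + y) / 2` between the positive and the negative half line (`charFun_limit`). Lévy's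
continuity theorem and a sandwich of sums between interval probabilities conclude. -/

/-! ### Unfolding the half line to ℤ -/

/-- The coin angle used at time `t`. -/
def angles (θ : Fin 2 → ℝ) (t : ℕ) : ℝ := if Even t then θ 0 else θ 1

/-- The first row of the transition kernel of the walk on `ℤ` whose coins are the rotations by the
angles `ϑ t`. -/
noncomputable def kernel (ϑ : ℕ → ℝ) : ℕ → ℤ → ℝ × ℝ
  | 0, x => (if x = 0 then 1 else 0, 0)
  | t + 1, x =>
    (Real.cos (ϑ t) * (kernel ϑ t (x + 1)).1 - Real.sin (ϑ t) * (kernel ϑ t (-x - 1)).2,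
      Real.cos (ϑ t) * (kernel ϑ t (x + 1)).2 + Real.sin (ϑ t) * (kernel ϑ t (-x - 1)).1)

theorem kernel_eq_zero_of_lt (ϑ : ℕ → ℝ) (t : ℕ) :
    ∀ x : ℤ, (t : ℤ) < |x| → kernel ϑ t x = 0 := by
  induction t with
  | zero =>
    intro x hx
    have : x ≠ 0 := by rintro rfl; simp at hx
    simp [kernel, this]
  | succ t ih =>
    intro x hx
    have h1 : (t : ℤ) < |x + 1| := by push_cast at hx; grind
    have h2 : (t : ℤ) < |-x - 1| := by push_cast at hx; grind
    simp [kernel, ih _ h1, ih _ h2]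

/-- Translation by one changes the parity of the site and reflection keeps it. Hence of two
neighbouring sites at most one is occupied, which removes cross terms from the probabilities. -/
theorem kernel_eq_zero_of_odd (ϑ : ℕ → ℝ) (t : ℕ) :
    ∀ x : ℤ, Odd (t + x) → kernel ϑ t x = 0 := by
  induction t with
  | zero =>
    intro x hx
    have : x ≠ 0 := by rintro rfl; simp at hx
    simp [kernel, this]
  | succ t ih =>
    intro x hx
    have h1 : Odd (t + (x + 1)) := by push_cast at hx; grind
    have h2 : Odd (t + (-x - 1)) := by push_cast at hx; grind
    simp [kernel, ih _ h1, ih _ h2]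

/-- The exponent `x + t` is unchanged when inner state 0 moves and grows by 2 when inner state 1
moves; the resulting sign turns the coin, of determinant `-1`, into a rotation. At the boundary it
grows by 1, and the extra `I` exchanges the two groups of terms. -/
theorem state_eq_kernel (θ : Fin 2 → ℝ) (α β : ℂ) (t : ℕ) : ∀ x : ℕ,
    (I ^ (x + t) * state θ α β t x 0
      = α * (kernel (angles θ) t x).1 + β * (kernel (angles θ) t x).2
        + I * (α * (kernel (angles θ) t (x + 1)).2 - β * (kernel (angles θ) t (x + 1)).1)) ∧
    (I ^ (x + t) * state θ α β t x 1
      = -α * (kernel (angles θ) t (-x)).2 + β * (kernel (angles θ) t (-x)).1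
        + I * (β * (kernel (angles θ) t (-x - 1)).2 + α * (kernel (angles θ) t (-x - 1)).1)) := by
  induction t with
  | zero =>
    intro x
    rcases x with _ | x
    · simp [state, initial, kernel]
    · have h1 : (x : ℤ) + 1 ≠ 0 := by omega
      have h2 : (x : ℤ) + 1 + 1 ≠ 0 := by omega
      have h3 : -1 + -(x : ℤ) ≠ 0 := by omega
      have h4 : -1 + -(x : ℤ) - 1 ≠ 0 := by omega
      simp [state, initial, kernel, h1, h2, h3, h4]
  | succ t ih =>
    intro x
    have hs0 : ∀ y, coinStep (angles θ t) (state θ α β t) y 0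
        = (Real.cos (angles θ t) : ℂ) * state θ α β t y 0
          + (Real.sin (angles θ t) : ℂ) * state θ α β t y 1 := by
      intro y; simp [coinStep, coin, Matrix.mulVec, dotProduct, Fin.sum_univ_two]
    have hs1 : ∀ y, coinStep (angles θ t) (state θ α β t) y 1
        = (Real.sin (angles θ t) : ℂ) * state θ α β t y 0
          - (Real.cos (angles θ t) : ℂ) * state θ α β t y 1 := by
      intro y; simp [coinStep, coin, Matrix.mulVec, dotProduct, Fin.sum_univ_two]; ring
    have hI : I * I = -1 := I_mul_I
    constructor
    · have e : state θ α β (t + 1) x 0 = coinStep (angles θ t) (state θ α β t) (x + 1) 0 := by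
        cases x <;> rfl
      obtain ⟨ha, hb⟩ := ih (x + 1)
      rw [e, hs0]
      simp only [kernel]
      push_cast at ha hb ⊢
      rw [show -((x : ℤ) + 1) = -(x : ℤ) - 1 by ring] at hb
      rw [show -((x : ℤ) + 1) - 1 = -(x : ℤ) - 1 - 1 by ring]
      linear_combination (Complex.cos (angles θ t : ℂ)) * ha + (Complex.sin (angles θ t : ℂ)) * hb
    · rcases x with _ | x
      · have e : state θ α β (t + 1) 0 1 = coinStep (angles θ t) (state θ α β t) 0 0 := rfl
        obtain ⟨ha, hb⟩ := ih 0
        rw [e, hs0]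
        simp only [kernel]
        push_cast at ha hb ⊢
        norm_num at ha hb ⊢
        linear_combination I * (Complex.cos (angles θ t : ℂ)) * ha
          + I * (Complex.sin (angles θ t : ℂ)) * hb
          + (Complex.cos (angles θ t : ℂ) * (α * (kernel (angles θ) t 1).2
              - β * (kernel (angles θ) t 1).1)
            + Complex.sin (angles θ t : ℂ) * (β * (kernel (angles θ) t (-1)).2
              + α * (kernel (angles θ) t (-1)).1)) * hI
      · have e : state θ α β (t + 1) (x + 1) 1 = coinStep (angles θ t) (state θ α β t) x 1 := rfl
        obtain ⟨ha, hb⟩ := ih x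
        rw [e, hs1]
        simp only [kernel]
        push_cast at ha hb ⊢
        rw [show -((x : ℤ) + 1) + 1 = -(x : ℤ) by ring,
          show -((x : ℤ) + 1) - 1 + 1 = -(x : ℤ) - 1 by ring,
          show -(-((x : ℤ) + 1)) - 1 = x by ring,
          show -(-((x : ℤ) + 1) - 1) - 1 = x + 1 by ring]
        rw [show x + 1 + (t + 1) = (x + t) + 2 by ring, pow_add, I_sq]
        linear_combination -(Complex.sin (angles θ t : ℂ)) * ha
          + (Complex.cos (angles θ t : ℂ)) * hb

/-- The position distribution belonging to `kernel`. -/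
noncomputable def weight (ϑ : ℕ → ℝ) (t : ℕ) (x : ℤ) : ℝ :=
  (kernel ϑ t x).1 ^ 2 + (kernel ϑ t x).2 ^ 2

theorem weight_nonneg (ϑ : ℕ → ℝ) (t : ℕ) (x : ℤ) : 0 ≤ weight ϑ t x := by
  unfold weight; positivity

/-- Since `p` and `q` are real, the two cross terms are opposite and cancel. This is where the
initial state disappears. -/
theorem norm_sq_add_norm_sq_eq (α β : ℂ) (h : ‖α‖ ^ 2 + ‖β‖ ^ 2 = 1) (p q : ℝ) :
    ‖α * p + β * q‖ ^ 2 + ‖α * q - β * p‖ ^ 2 = p ^ 2 + q ^ 2 := by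
  simp only [← normSq_eq_norm_sq, normSq_apply] at h ⊢
  simp
  linear_combination (p ^ 2 + q ^ 2) * h

theorem prob_eq (θ : Fin 2 → ℝ) (α β : ℂ) (t x : ℕ) (j : Fin 2) :
    prob θ α β t x j = ‖I ^ (x + t) * state θ α β t x j‖ ^ 2 := by
  simp [prob]

/-- The mass of site `x` is divided between the positions `x` and `x - 1`. The division depends on
`α`, `β`; its total does not. -/
theorem exists_prob_zero_eq (θ : Fin 2 → ℝ) (α β : ℂ) (h : ‖α‖ ^ 2 + ‖β‖ ^ 2 = 1) (t : ℕ) :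
    ∃ a b : ℤ → ℝ, (∀ x, 0 ≤ a x) ∧ (∀ x, 0 ≤ b x) ∧ (∀ x, a x + b x = weight (angles θ) t x) ∧
      ∀ x : ℕ, prob θ α β t x 0 = a x + b (x + 1) := by
  refine ⟨fun x => ‖α * (kernel (angles θ) t x).1 + β * (kernel (angles θ) t x).2‖ ^ 2,
    fun x => ‖α * (kernel (angles θ) t x).2 - β * (kernel (angles θ) t x).1‖ ^ 2,
    fun x => by positivity, fun x => by positivity,
    fun x => norm_sq_add_norm_sq_eq α β h _ _, fun x => ?_⟩
  rw [prob_eq, (state_eq_kernel θ α β t x).1]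
  rcases Int.even_or_odd (t + x : ℤ) with hx | hx
  · simp [kernel_eq_zero_of_odd (angles θ) t (x + 1) (by rw [← add_assoc]; exact hx.add_one)]
  · simp [kernel_eq_zero_of_odd (angles θ) t x hx]

theorem exists_prob_one_eq (θ : Fin 2 → ℝ) (α β : ℂ) (h : ‖α‖ ^ 2 + ‖β‖ ^ 2 = 1) (t : ℕ) :
    ∃ a b : ℤ → ℝ, (∀ x, 0 ≤ a x) ∧ (∀ x, 0 ≤ b x) ∧
      (∀ x, a x + b x = weight (angles θ) t (-x)) ∧
      ∀ x : ℕ, prob θ α β t x 1 = a x + b (x + 1) := by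
  refine ⟨fun x => ‖-α * (kernel (angles θ) t (-x)).2 + β * (kernel (angles θ) t (-x)).1‖ ^ 2,
    fun x => ‖β * (kernel (angles θ) t (-x)).2 + α * (kernel (angles θ) t (-x)).1‖ ^ 2,
    fun x => by positivity, fun x => by positivity,
    fun x => ?_, fun x => ?_⟩
  · simp only [weight]
    rw [← norm_sq_add_norm_sq_eq α β h (kernel (angles θ) t (-x)).1 (kernel (angles θ) t (-x)).2,
      add_comm, add_comm (β * _), ← norm_neg (-α * _ + _), neg_add, neg_mul, neg_neg,
      ← sub_eq_add_neg]
  rw [prob_eq, (state_eq_kernel θ α β t x).2]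
  rcases Int.even_or_odd (t + x : ℤ) with hx | hx
  · have h1 : Odd ((t : ℤ) + (-x - 1)) := by grind
    simp only [neg_add']
    simp [kernel_eq_zero_of_odd (angles θ) t (-x - 1) h1]
  · have h1 : Odd ((t : ℤ) + (-x)) := by grind
    simp only [neg_add']
    simp [kernel_eq_zero_of_odd (angles θ) t (-x) h1]

/-- Sums of consecutive terms `a x + b (x + 1)` compared with sums of `a x + b x`. -/
theorem sum_staggered_bounds {f : ℕ → ℝ} {w a b : ℤ → ℝ} (ha : ∀ x, 0 ≤ a x) (hb : ∀ x, 0 ≤ b x)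
    (hw : ∀ x, a x + b x = w x) (hf : ∀ x : ℕ, f x = a x + b (x + 1)) (m : ℕ) :
    ∑ x ∈ Finset.Icc (1 : ℤ) m, w x ≤ ∑ x ∈ Finset.range (m + 1), f x ∧
      ∑ x ∈ Finset.range (m + 1), f x ≤ ∑ x ∈ Finset.Icc (0 : ℤ) (m + 1), w x := by
  have e : ∀ x, w x = a x + b x := fun x => (hw x).symm
  -- Sites strictly inside contribute their whole mass; only the two end sites are cut.
  have key : ∀ m : ℕ, ∑ x ∈ Finset.range (m + 1), f x
      = ∑ x ∈ Finset.Icc (1 : ℤ) m, w x + a 0 + b (m + 1) := by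
    intro m
    induction m with
    | zero => simp [hf]
    | succ m ih =>
      rw [Finset.sum_range_succ, ih, hf]
      have : Finset.Icc (1 : ℤ) ((m + 1 : ℕ) : ℤ)
          = insert ((m : ℤ) + 1) (Finset.Icc (1 : ℤ) m) := by
        ext x; simp only [Finset.mem_Icc, Finset.mem_insert]; push_cast; omega
      rw [this, Finset.sum_insert (by simp)]
      push_cast
      rw [e]; ring
  have h2 : Finset.Icc (0 : ℤ) (m + 1)
      = insert 0 (insert ((m : ℤ) + 1) (Finset.Icc (1 : ℤ) m)) := by
    ext x; simp only [Finset.mem_Icc, Finset.mem_insert]; omega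
  rw [key, h2, Finset.sum_insert (by simp; omega), Finset.sum_insert (by simp)]
  have := ha 0; have := hb 0; have := ha (m + 1); have := hb (m + 1); have := e 0
  have := e (m + 1)
  constructor <;> linarith

/-! ### Fourier transform and Parseval -/

/-- The Fourier transform of `kernel`. -/
noncomputable def symbol (ϑ : ℕ → ℝ) (k : ℝ) : ℕ → ℂ × ℂ
  | 0 => (1, 0)
  | t + 1 =>
    (exp (-(k * I)) * (Real.cos (ϑ t) * (symbol ϑ k t).1 - Real.sin (ϑ t) * conj (symbol ϑ k t).2),
      exp (-(k * I)) * (Real.cos (ϑ t) * (symbol ϑ k t).2 + Real.sin (ϑ t) * conj (symbol ϑ k t).1))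

/-- Because the kernel is real, reflecting the site conjugates its transform; translation gives the
phase. The recursion therefore closes at each single `k`. -/
theorem hasSum_kernel (ϑ : ℕ → ℝ) (k : ℝ) (t : ℕ) :
    HasSum (fun x : ℤ => ((kernel ϑ t x).1 : ℂ) * exp (k * x * I)) (symbol ϑ k t).1 ∧
      HasSum (fun x : ℤ => ((kernel ϑ t x).2 : ℂ) * exp (k * x * I)) (symbol ϑ k t).2 := by
  induction t with
  | zero =>
    constructor
    · convert! hasSum_single (0 : ℤ) (f := fun x : ℤ => ((kernel ϑ 0 x).1 : ℂ) * exp (k * x * I)) ?_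
        using 1
      · simp [kernel, symbol]
      · intro x hx; simp [kernel, hx]
    · simp [kernel, symbol, hasSum_zero]
  | succ t ih =>
    obtain ⟨h1, h2⟩ := ih
    have shift : ∀ {f : ℤ → ℝ} {a : ℂ}, HasSum (fun x : ℤ => (f x : ℂ) * exp (k * x * I)) a →
        HasSum (fun x : ℤ => (f (x + 1) : ℂ) * exp (k * x * I)) (exp (-(k * I)) * a) := by
      intro f a h
      have := ((Equiv.addRight (1 : ℤ)).hasSum_iff.2 h).mul_left (exp (-(k * I)))
      refine this.congr_fun fun x => ?_
      simp only [Function.comp, Equiv.coe_addRight]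
      rw [mul_left_comm, ← exp_add]
      push_cast
      ring_nf
    have refl : ∀ {f : ℤ → ℝ} {a : ℂ}, HasSum (fun x : ℤ => (f x : ℂ) * exp (k * x * I)) a →
        HasSum (fun x : ℤ => (f (-x) : ℂ) * exp (k * x * I)) (conj a) := by
      intro f a h
      have := (Equiv.neg ℤ).hasSum_iff.2 (hasSum_conj'.2 h)
      refine this.congr_fun fun x => ?_
      simp only [Function.comp, Equiv.neg_apply, map_mul, conj_ofReal, ← exp_conj, conj_I]
      push_cast
      simp
    constructor
    · have := ((shift h1).mul_left (Real.cos (ϑ t) : ℂ)).sub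
        ((shift (refl h2)).mul_left (Real.sin (ϑ t) : ℂ))
      convert! this using 1
      · ext x; simp only [kernel, ← neg_add']; push_cast; ring
      · simp only [symbol]; ring
    · have := ((shift h2).mul_left (Real.cos (ϑ t) : ℂ)).add
        ((shift (refl h1)).mul_left (Real.sin (ϑ t) : ℂ))
      convert! this using 1
      · ext x; simp only [kernel, ← neg_add']; push_cast; ring
      · simp only [symbol]; ring

theorem symbol_eq_sum (ϑ : ℕ → ℝ) (k : ℝ) (t : ℕ) :
    (symbol ϑ k t).1 = ∑ x ∈ Icc (-t : ℤ) t, ((kernel ϑ t x).1 : ℂ) * exp (k * x * I) ∧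
      (symbol ϑ k t).2 = ∑ x ∈ Icc (-t : ℤ) t, ((kernel ϑ t x).2 : ℂ) * exp (k * x * I) := by
  have hz : ∀ x ∉ Icc (-t : ℤ) t, kernel ϑ t x = 0 := by
    intro x hx
    refine kernel_eq_zero_of_lt ϑ t x ?_
    simp only [Finset.mem_Icc] at hx
    grind
  refine ⟨(hasSum_kernel ϑ k t).1.unique (hasSum_sum_of_ne_finset_zero fun x hx => ?_),
    (hasSum_kernel ϑ k t).2.unique (hasSum_sum_of_ne_finset_zero fun x hx => ?_)⟩ <;>
  simp [hz x hx]

/-- Unitarity of a step. Integrated over `k`, it also makes the weights sum to 1. -/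
theorem normSq_symbol (ϑ : ℕ → ℝ) (k : ℝ) (t : ℕ) :
    conj (symbol ϑ k t).1 * (symbol ϑ k t).1 + conj (symbol ϑ k t).2 * (symbol ϑ k t).2 = 1 := by
  induction t with
  | zero => simp [symbol]
  | succ t ih =>
    have h1 : exp (k * I) * exp (-(k * I)) = 1 := by rw [← exp_add]; simp
    have h2 : (Real.sin (ϑ t) : ℂ) ^ 2 + (Real.cos (ϑ t) : ℂ) ^ 2 = 1 := by
      exact_mod_cast congrArg ((↑) : ℝ → ℂ) (Real.sin_sq_add_cos_sq (ϑ t))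
    simp only [symbol, map_mul, map_sub, map_add, conj_ofReal, ← exp_conj, map_neg, conj_I,
      conj_conj, mul_neg, neg_neg]
    linear_combination ((Real.sin (ϑ t) : ℂ) ^ 2 + (Real.cos (ϑ t) : ℂ) ^ 2) * ih + h2
      + ((Real.sin (ϑ t) : ℂ) ^ 2 + (Real.cos (ϑ t) : ℂ) ^ 2)
        * (conj (symbol ϑ k t).1 * (symbol ϑ k t).1 + conj (symbol ϑ k t).2 * (symbol ϑ k t).2) * h1

theorem norm_symbol_le (ϑ : ℕ → ℝ) (k : ℝ) (t : ℕ) :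
    ‖(symbol ϑ k t).1‖ ≤ 1 ∧ ‖(symbol ϑ k t).2‖ ≤ 1 := by
  have h := normSq_symbol ϑ k t
  rw [conj_mul', conj_mul'] at h
  norm_cast at h
  constructor <;> nlinarith [norm_nonneg (symbol ϑ k t).1, norm_nonneg (symbol ϑ k t).2,
    sq_nonneg ‖(symbol ϑ k t).1‖, sq_nonneg ‖(symbol ϑ k t).2‖]

theorem continuous_symbol (ϑ : ℕ → ℝ) (t : ℕ) : Continuous fun k : ℝ => symbol ϑ k t := by
  induction t with
  | zero => exact continuous_const
  | succ t ih => simp only [symbol]; fun_prop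

theorem integral_exp_int_mul (n : ℤ) :
    ∫ k in (0 : ℝ)..(2 * Real.pi), exp (k * n * I) = if n = 0 then (2 * Real.pi : ℂ) else 0 := by
  split_ifs with h
  · simp [h]
  · have hn : (n : ℂ) * I ≠ 0 := by simp [h]
    have := integral_exp_mul_complex (a := 0) (b := 2 * Real.pi) hn
    rw [show (fun k : ℝ => exp (k * n * I)) = fun k : ℝ => exp (n * I * k) by ext; ring_nf, this]
    have : exp (n * I * ((2 * Real.pi : ℝ) : ℂ)) = 1 := by
      rw [← exp_int_mul_two_pi_mul_I n]; push_cast; ring_nf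
    rw [this]; simp

theorem integral_conj_sum_mul_sum (s : Finset ℤ) (f g : ℤ → ℂ) :
    ∫ k in (0 : ℝ)..(2 * Real.pi),
        conj (∑ x ∈ s, f x * exp (k * x * I)) * ∑ x ∈ s, g x * exp (k * x * I)
      = 2 * Real.pi * ∑ x ∈ s, conj (f x) * g x := by
  have e : ∀ k : ℝ, conj (∑ x ∈ s, f x * exp (k * x * I)) * ∑ x ∈ s, g x * exp (k * x * I)
      = ∑ x ∈ s, ∑ y ∈ s, conj (f x) * g y * exp (k * (y - x : ℤ) * I) := by
    intro k
    rw [map_sum, Finset.sum_mul_sum]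
    refine Finset.sum_congr rfl fun x _ => Finset.sum_congr rfl fun y _ => ?_
    simp only [map_mul, ← exp_conj, conj_ofReal, conj_I, map_intCast]
    rw [mul_mul_mul_comm, ← exp_add]
    push_cast
    ring_nf
  simp_rw [e]
  rw [intervalIntegral.integral_finsetSum fun x _ =>
    Continuous.intervalIntegrable (by fun_prop) _ _,
    Finset.mul_sum]
  refine Finset.sum_congr rfl fun x hx => ?_
  rw [intervalIntegral.integral_finsetSum fun x _ =>
    Continuous.intervalIntegrable (by fun_prop) _ _]
  simp_rw [intervalIntegral.integral_const_mul, integral_exp_int_mul]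
  rw [Finset.sum_eq_single x]
  · simp; ring
  · intro y _ hy
    rw [if_neg (sub_ne_zero.2 hy), mul_zero]
  · exact fun h => absurd hx h

/-- The overlap of the symbol at two points. -/
noncomputable def overlap (ϑ : ℕ → ℝ) (t : ℕ) (k l : ℝ) : ℂ :=
  conj (symbol ϑ k t).1 * (symbol ϑ l t).1 + conj (symbol ϑ k t).2 * (symbol ϑ l t).2

/-- Shifting `k` by `δ` multiplies the coefficient at `x` by `exp (δ * x * I)`, so Parseval, applied
to each component and its shift, produces the squared coefficients with this factor. -/
theorem sum_weight_mul_exp (ϑ : ℕ → ℝ) (t : ℕ) (δ : ℝ) :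
    ∑ x ∈ Icc (-t : ℤ) t, (weight ϑ t x : ℂ) * exp (δ * x * I)
      = (2 * Real.pi : ℂ)⁻¹ * ∫ k in (0 : ℝ)..(2 * Real.pi), overlap ϑ t k (k + δ) := by
  have hp : (2 * Real.pi : ℂ) ≠ 0 := by simp [Real.pi_ne_zero]
  have c1 := fun t => (continuous_symbol ϑ t).fst
  have c2 := fun t => (continuous_symbol ϑ t).snd
  have key : ∀ (f : ℤ → ℝ) (F : ℝ → ℂ),
      (∀ k : ℝ, F k = ∑ x ∈ Icc (-t : ℤ) t, (f x : ℂ) * exp (k * x * I)) →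
      ∫ k in (0 : ℝ)..(2 * Real.pi), conj (F k) * F (k + δ)
        = 2 * Real.pi * ∑ x ∈ Icc (-t : ℤ) t, (f x : ℂ) ^ 2 * exp (δ * x * I) := by
    intro f F hF
    have := integral_conj_sum_mul_sum (Icc (-t : ℤ) t) (fun x => f x)
      fun x => f x * exp (δ * x * I)
    have e1 : ∀ k : ℝ, ∑ x ∈ Icc (-t : ℤ) t, (f x : ℂ) * exp ((k + δ : ℝ) * x * I)
        = ∑ x ∈ Icc (-t : ℤ) t, (f x : ℂ) * exp (δ * x * I) * exp (k * x * I) := fun k =>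
      Finset.sum_congr rfl fun x _ => by
        rw [mul_assoc (f x : ℂ) (exp _), ← exp_add]; push_cast; ring_nf
    simp_rw [hF, e1, this]
    refine congrArg _ (Finset.sum_congr rfl fun x _ => ?_)
    rw [conj_ofReal]; ring
  have k1 := key (fun x => (kernel ϑ t x).1) (fun k => (symbol ϑ k t).1)
    fun k => (symbol_eq_sum ϑ k t).1
  have k2 := key (fun x => (kernel ϑ t x).2) (fun k => (symbol ϑ k t).2)
    fun k => (symbol_eq_sum ϑ k t).2
  unfold overlap
  rw [intervalIntegral.integral_add, k1, k2, ← mul_add, inv_mul_cancel_left₀ hp,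
    ← Finset.sum_add_distrib]
  · refine Finset.sum_congr rfl fun x _ => ?_
    simp [weight]; ring
  · exact Continuous.intervalIntegrable ((continuous_conj.comp (c1 t)).mul
      ((c1 t).comp (continuous_id.add continuous_const))) _ _
  · exact Continuous.intervalIntegrable ((continuous_conj.comp (c2 t)).mul
      ((c2 t).comp (continuous_id.add continuous_const))) _ _

theorem sum_weight (ϑ : ℕ → ℝ) (t : ℕ) : ∑ x ∈ Icc (-t : ℤ) t, weight ϑ t x = 1 := by
  have h := sum_weight_mul_exp ϑ t 0
  have : ∀ k, overlap ϑ t k (k + 0) = 1 := fun k => by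
    rw [add_zero]; exact normSq_symbol ϑ k t
  simp_rw [this] at h
  have hp : (2 * Real.pi : ℂ) ≠ 0 := by simp [Real.pi_ne_zero]
  simp only [ofReal_zero, zero_mul, exp_zero, mul_one, intervalIntegral.integral_const, sub_zero,
    real_smul] at h
  push_cast at h
  rw [inv_mul_cancel₀ hp] at h
  exact_mod_cast h

/-! ### The rescaled law and its characteristic function -/

/-- The law of the rescaled position. -/
noncomputable def rescaledLaw (ϑ : ℕ → ℝ) (t : ℕ) : Measure ℝ :=
  ∑ x ∈ Icc (-t : ℤ) t, ENNReal.ofReal (weight ϑ t x) • Measure.dirac ((x : ℝ) / t)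

instance (ϑ : ℕ → ℝ) (t : ℕ) : IsProbabilityMeasure (rescaledLaw ϑ t) := by
  constructor
  simp only [rescaledLaw, Measure.coe_finsetSum, Finset.sum_apply, Measure.smul_apply,
    measure_univ, smul_eq_mul, mul_one]
  rw [← ENNReal.ofReal_sum_of_nonneg fun x _ => weight_nonneg ϑ t x, sum_weight, ENNReal.ofReal_one]

open scoped Classical in
theorem rescaledLaw_apply (ϑ : ℕ → ℝ) (t : ℕ) {s : Set ℝ} (hs : MeasurableSet s) :
    (rescaledLaw ϑ t).real s
      = ∑ x ∈ (Icc (-t : ℤ) t).filter (fun x : ℤ => (x : ℝ) / t ∈ s), weight ϑ t x := by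
  have : (rescaledLaw ϑ t) s
      = ENNReal.ofReal (∑ x ∈ Icc (-t : ℤ) t, if (x : ℝ) / t ∈ s then weight ϑ t x else 0) := by
    rw [ENNReal.ofReal_sum_of_nonneg fun x _ => by split_ifs <;> simp [weight_nonneg]]
    simp only [rescaledLaw, Measure.coe_finsetSum, Finset.sum_apply, Measure.smul_apply,
      smul_eq_mul, Measure.dirac_apply' _ hs]
    refine Finset.sum_congr rfl fun x _ => ?_
    by_cases h : (x : ℝ) / t ∈ s <;> simp [h]
  rw [measureReal_def, this, ENNReal.toReal_ofReal, Finset.sum_filter]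
  exact Finset.sum_nonneg fun x _ => by split_ifs <;> simp [weight_nonneg]

theorem charFun_rescaledLaw (ϑ : ℕ → ℝ) (t : ℕ) (ζ : ℝ) :
    charFun (rescaledLaw ϑ t) ζ
      = (2 * Real.pi : ℂ)⁻¹ * ∫ k in (0 : ℝ)..(2 * Real.pi), overlap ϑ t k (k + ζ / t) := by
  rw [← sum_weight_mul_exp, charFun_apply_real, rescaledLaw, integral_finsetSum_measure]
  · refine Finset.sum_congr rfl fun x _ => ?_
    rw [integral_smul_measure, integral_dirac, ENNReal.toReal_ofReal (weight_nonneg _ _ _),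
      real_smul]
    push_cast
    ring_nf
  · intro x _
    refine Integrable.smul_measure ?_ (by simp)
    exact integrable_dirac (by simp)

theorem tendsto_atTop_of_even_of_odd {X : Type*} {f : ℕ → X} {l : Filter X}
    (h0 : Tendsto (fun n => f (2 * n)) atTop l) (h1 : Tendsto (fun n => f (2 * n + 1)) atTop l) :
    Tendsto f atTop l := by
  intro s hs
  obtain ⟨N, hN⟩ := mem_atTop_sets.1 (h0 hs)
  obtain ⟨M, hM⟩ := mem_atTop_sets.1 (h1 hs)
  refine mem_atTop_sets.2 ⟨2 * N + 2 * M + 1, fun t ht => ?_⟩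
  rcases Nat.even_or_odd' t with ⟨n, rfl | rfl⟩
  · exact hN n (by omega)
  · exact hM n (by omega)

/-! ### Asymptotics of the overlap -/

/-- The overlap of two rotations by the angles `n ω(k)` and `n ω(uₙ)`, whose axes are close. -/
theorem tendsto_rotation_overlap {ω m : ℝ → ℝ} {r : ℝ → ℂ} {k ω' η : ℝ} (hω : HasDerivAt ω ω' k)
    (hm : ContinuousAt m k) (hr : ContinuousAt r k) (h1 : (m k : ℂ) ^ 2 + conj (r k) * r k = 1)
    {u : ℕ → ℝ} (hu : Tendsto u atTop (𝓝 k))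
    (hη : Tendsto (fun n : ℕ => n * (u n - k)) atTop (𝓝 η))
    {e f : ℕ → ℂ} (he : Tendsto e atTop (𝓝 1)) (hf : Tendsto f atTop (𝓝 1)) :
    Tendsto (fun n : ℕ =>
      e n * (conj (Real.cos (n * ω k) + I * m k * Real.sin (n * ω k)) *
          (Real.cos (n * ω (u n)) + I * m (u n) * Real.sin (n * ω (u n)))) +
        f n * (conj (r k * Real.sin (n * ω k)) * (r (u n) * Real.sin (n * ω (u n)))))
      atTop (𝓝 (Real.cos (η * ω') + I * m k * Real.sin (η * ω'))) := by
  have hphase : Tendsto (fun n : ℕ => n * ω (u n) - n * ω k) atTop (𝓝 (η * ω')) := by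
    have hd : Tendsto (fun n => dslope ω k (u n)) atTop (𝓝 ω') := by
      have := (continuousAt_dslope_same.2 hω.differentiableAt).tendsto.comp hu
      rwa [dslope_same, hω.deriv] at this
    refine (hη.mul hd).congr fun n => ?_
    have := sub_smul_dslope ω k (u n)
    simp only [smul_eq_mul] at this
    rw [mul_assoc, this]; ring
  -- With the axis frozen at `k` and `e`, `f` replaced by 1, the addition theorems and `h1` make the
  -- overlap exactly `hmain`. The errors `t1`, `t2`, `t3` are bounded factors times null sequences.
  have hbd : ∀ {x y : ℕ → ℂ}, (∀ n, ‖x n‖ ≤ 2 + |m k| + ‖r k‖) → Tendsto y atTop (𝓝 0) →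
      Tendsto (fun n => x n * y n) atTop (𝓝 0) := by
    intro x y hx hy
    rw [tendsto_zero_iff_norm_tendsto_zero] at hy ⊢
    refine squeeze_zero (fun _ => norm_nonneg _) (fun n => ?_)
      (by simpa using hy.const_mul (2 + |m k| + ‖r k‖))
    rw [norm_mul]
    exact mul_le_mul_of_nonneg_right (hx n) (norm_nonneg _)
  have hmu : Tendsto (fun n => (m (u n) : ℂ)) atTop (𝓝 (m k)) :=
    (continuous_ofReal.tendsto _).comp (hm.tendsto.comp hu)
  have hru : Tendsto (fun n => r (u n)) atTop (𝓝 (r k)) := hr.tendsto.comp hu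
  have hcos : ∀ y : ℝ, ‖(Real.cos y : ℂ)‖ ≤ 1 := fun y => by
    rw [norm_real]; exact Real.abs_cos_le_one y
  have hsin : ∀ y : ℝ, ‖(Real.sin y : ℂ)‖ ≤ 1 := fun y => by
    rw [norm_real]; exact Real.abs_sin_le_one y
  have hA : ∀ y z : ℝ, ‖(z : ℂ)‖ ≤ 1 → ‖(Real.cos y - I * m k * Real.sin y) * z‖
      ≤ 2 + |m k| + ‖r k‖ := by
    intro y z hz
    have h3 : ‖(Real.cos y - I * m k * Real.sin y : ℂ)‖ ≤ 1 + |m k| := by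
      refine (norm_sub_le _ _).trans (add_le_add (hcos y) ?_)
      rw [norm_mul, norm_mul, norm_I, one_mul, norm_real, Real.norm_eq_abs]
      exact mul_le_of_le_one_right (abs_nonneg _) (hsin y)
    rw [norm_mul]
    have := mul_le_mul h3 hz (norm_nonneg _) (by positivity)
    have := norm_nonneg (r k)
    linarith
  have hB : ∀ y z : ℝ, ‖(z : ℂ)‖ ≤ 1 → ‖conj (r k * Real.sin y) * z‖ ≤ 2 + |m k| + ‖r k‖ := by
    intro y z hz
    rw [norm_mul, norm_conj, norm_mul]
    have h3 := mul_le_of_le_one_right (norm_nonneg (r k)) (hsin y)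
    have := mul_le_mul h3 hz (norm_nonneg _) (by positivity)
    have := abs_nonneg (m k)
    linarith
  have hmain : Tendsto (fun n : ℕ => (Real.cos (n * ω (u n) - n * ω k) : ℂ)
      + I * m k * Real.sin (n * ω (u n) - n * ω k)) atTop
      (𝓝 (Real.cos (η * ω') + I * m k * Real.sin (η * ω'))) := by
    have hc : Continuous fun y : ℝ => (Real.cos y : ℂ) + I * m k * Real.sin y := by fun_prop
    exact (hc.tendsto _).comp hphase
  have t1 := hbd (fun n => hA (n * ω k) (Real.cos (n * ω (u n))) (hcos _))
    (y := fun n => e n - 1) (by simpa using he.sub_const 1)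
  have t2 := hbd (fun n => hA (n * ω k) (Real.sin (n * ω (u n))) (hsin _))
    (y := fun n => I * (e n * m (u n) - m k))
    (by simpa using ((he.mul hmu).sub_const (m k : ℂ)).const_mul I)
  have t3 := hbd (fun n => hB (n * ω k) (Real.sin (n * ω (u n))) (hsin _))
    (y := fun n => f n * r (u n) - r k) (by simpa using (hf.mul hru).sub_const (r k))
  have := ((hmain.add t1).add t2).add t3
  simp only [add_zero] at this
  refine this.congr fun n => ?_
  rw [Real.cos_sub, Real.sin_sub]
  simp only [map_add, map_mul, conj_I, conj_ofReal, ofReal_add, ofReal_sub, ofReal_mul]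
  linear_combination (Real.sin (n * ω k) : ℂ) * Real.sin (n * ω (u n)) * (m k : ℂ) ^ 2 * I_mul_I
    - (Real.sin (n * ω k) : ℂ) * Real.sin (n * ω (u n)) * h1

section TwoPeriod

/-- `cos ω(k)` for the quasi-energy `ω(k)` of two steps. -/
noncomputable def cosEnergy (a b k : ℝ) : ℝ := a * Real.cos (2 * k) - b

/-- The group velocity of two steps, per step. -/
noncomputable def velocity (a b k : ℝ) : ℝ :=
  -(a * Real.sin (2 * k)) / Real.sqrt (1 - cosEnergy a b k ^ 2)

/-- The second entry of the symbol of two steps. -/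
noncomputable def offDiag (φ ψ k : ℝ) : ℂ :=
  Real.sin φ * Real.cos ψ * exp (-(2 * k * I)) + Real.cos φ * Real.sin ψ

theorem normSq_two_step (φ ψ k : ℝ) :
    cosEnergy (Real.cos φ * Real.cos ψ) (Real.sin φ * Real.sin ψ) k ^ 2
      + (Real.cos φ * Real.cos ψ * Real.sin (2 * k)) ^ 2 + normSq (offDiag φ ψ k) = 1 := by
  have e : exp (-(2 * k * I)) = Real.cos (2 * k) - Real.sin (2 * k) * I := by
    rw [show -(2 * k * I : ℂ) = ((-(2 * k) : ℝ) : ℂ) * I by push_cast; ring, exp_mul_I,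
      ← ofReal_cos, ← ofReal_sin, Real.cos_neg, Real.sin_neg]
    push_cast; ring
  rw [offDiag, e, normSq_apply]
  simp [-ofReal_cos, -ofReal_sin, cosEnergy]
  have h1 := Real.sin_sq_add_cos_sq φ
  have h2 := Real.sin_sq_add_cos_sq ψ
  have h3 := Real.sin_sq_add_cos_sq (2 * k)
  linear_combination (Real.cos ψ ^ 2 * (Real.cos φ ^ 2 + Real.sin φ ^ 2)) * h3
    + (Real.cos ψ ^ 2 + Real.sin ψ ^ 2) * h1 + h2

/-- Away from the zeros of `sin (2 * k)` the quasi-energy stays off the band edges, so `arccos` is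
differentiable there and the velocity has a nonzero denominator. -/
theorem sq_cosEnergy_lt_one {φ ψ k : ℝ} (hφ : Real.cos φ ≠ 0) (hψ : Real.cos ψ ≠ 0)
    (hk : Real.sin (2 * k) ≠ 0) :
    cosEnergy (Real.cos φ * Real.cos ψ) (Real.sin φ * Real.sin ψ) k ^ 2 < 1 := by
  have := normSq_two_step φ ψ k
  have := normSq_nonneg (offDiag φ ψ k)
  have : 0 < (Real.cos φ * Real.cos ψ * Real.sin (2 * k)) ^ 2 := by positivity
  linarith

theorem symbol_two_step {ϑ : ℕ → ℝ} (hϑ : ∀ t, ϑ (t + 2) = ϑ t) (k : ℝ) (n : ℕ) :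
    (symbol ϑ k (2 * (n + 1))).1
        = (cosEnergy (Real.cos (ϑ 0) * Real.cos (ϑ 1)) (Real.sin (ϑ 0) * Real.sin (ϑ 1)) k
            - Real.cos (ϑ 0) * Real.cos (ϑ 1) * Real.sin (2 * k) * I) * (symbol ϑ k (2 * n)).1
          - offDiag (ϑ 0) (ϑ 1) k * conj (symbol ϑ k (2 * n)).2 ∧
      (symbol ϑ k (2 * (n + 1))).2
        = (cosEnergy (Real.cos (ϑ 0) * Real.cos (ϑ 1)) (Real.sin (ϑ 0) * Real.sin (ϑ 1)) k
            - Real.cos (ϑ 0) * Real.cos (ϑ 1) * Real.sin (2 * k) * I) * (symbol ϑ k (2 * n)).2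
          + offDiag (ϑ 0) (ϑ 1) k * conj (symbol ϑ k (2 * n)).1 := by
  have e0 : ∀ n, ϑ (2 * n) = ϑ 0 := by
    intro n; induction n with
    | zero => rfl
    | succ n ih => rw [← ih, ← hϑ (2 * n)]; rfl
  have e1 : ∀ n, ϑ (2 * n + 1) = ϑ 1 := by
    intro n; induction n with
    | zero => rfl
    | succ n ih => rw [← ih, ← hϑ (2 * n + 1)]; rfl
  have h1 : exp (-(k * I)) * exp (k * I) = 1 := by rw [← exp_add]; simp
  have h2 : exp (-(2 * k * I)) = exp (-(k * I)) ^ 2 := by rw [← exp_nat_mul]; push_cast; ring_nf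
  have h3 : (Real.cos (2 * k) : ℂ) - Real.sin (2 * k) * I = exp (-(k * I)) ^ 2 := by
    rw [← h2, show -(2 * k * I : ℂ) = ((-(2 * k) : ℝ) : ℂ) * I by push_cast; ring, exp_mul_I,
      ← ofReal_cos, ← ofReal_sin, Real.cos_neg, Real.sin_neg]
    push_cast; ring
  have h4 : (cosEnergy (Real.cos (ϑ 0) * Real.cos (ϑ 1)) (Real.sin (ϑ 0) * Real.sin (ϑ 1)) k
            - Real.cos (ϑ 0) * Real.cos (ϑ 1) * Real.sin (2 * k) * I : ℂ)
      = Real.cos (ϑ 0) * Real.cos (ϑ 1) * exp (-(k * I)) ^ 2 - Real.sin (ϑ 0) * Real.sin (ϑ 1) := by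
    rw [← h3, cosEnergy]; push_cast; ring
  rw [h4, offDiag, h2, show 2 * (n + 1) = 2 * n + 1 + 1 by ring]
  simp only [symbol, e0, e1, map_mul, map_add, map_sub, conj_conj, conj_ofReal, ← exp_conj, map_neg,
    conj_I, mul_neg, neg_neg]
  constructor
  · linear_combination (-(Real.sin (ϑ 1) : ℂ) * (Real.cos (ϑ 0) * conj (symbol ϑ k (2 * n)).2
      + Real.sin (ϑ 0) * (symbol ϑ k (2 * n)).1)) * h1
  · linear_combination ((Real.sin (ϑ 1) : ℂ) * (Real.cos (ϑ 0) * conj (symbol ϑ k (2 * n)).1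
      - Real.sin (ϑ 0) * (symbol ϑ k (2 * n)).2)) * h1

/-- The two-step matrix is special unitary with eigenvalues `exp (± I ω)`. Its powers keep the axis
and multiply the angle; the velocity is the diagonal component of the axis. -/
theorem symbol_even {ϑ : ℕ → ℝ} (hϑ : ∀ t, ϑ (t + 2) = ϑ t) {k a b ω : ℝ}
    (ha : a = Real.cos (ϑ 0) * Real.cos (ϑ 1)) (hb : b = Real.sin (ϑ 0) * Real.sin (ϑ 1))
    (hω : ω = Real.arccos (cosEnergy a b k)) (h : cosEnergy a b k ^ 2 < 1) (n : ℕ) :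
    (symbol ϑ k (2 * n)).1 = Real.cos (n * ω) + I * velocity a b k * Real.sin (n * ω) ∧
      (symbol ϑ k (2 * n)).2
        = offDiag (ϑ 0) (ϑ 1) k / Real.sqrt (1 - cosEnergy a b k ^ 2) * Real.sin (n * ω) := by
  have hN := normSq_two_step (ϑ 0) (ϑ 1) k
  rw [← ha, ← hb] at hN
  have hcos : Real.cos ω = cosEnergy a b k := by
    rw [hω, Real.cos_arccos] <;> nlinarith
  have hsin : Real.sin ω = Real.sqrt (1 - cosEnergy a b k ^ 2) := by rw [hω, Real.sin_arccos]
  have hpos : 0 < Real.sqrt (1 - cosEnergy a b k ^ 2) := Real.sqrt_pos.2 (by linarith)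
  rw [velocity, ← hsin] at *
  rw [← hcos] at hN
  have hs : (Real.sin ω : ℂ) ≠ 0 := by exact_mod_cast hpos.ne'
  have hN' : (Real.cos ω : ℂ) ^ 2 + ((a : ℂ) * Real.sin (2 * k)) ^ 2
      + offDiag (ϑ 0) (ϑ 1) k * conj (offDiag (ϑ 0) (ϑ 1) k) = 1 := by
    rw [mul_conj]; exact_mod_cast hN
  have hT : (Real.sin ω : ℂ) ^ 2 + (Real.cos ω : ℂ) ^ 2 = 1 := by
    exact_mod_cast Real.sin_sq_add_cos_sq ω
  induction n with
  | zero => simp [symbol]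
  | succ n ih =>
    obtain ⟨h1, h2⟩ := symbol_two_step hϑ k n
    rw [← ha, ← hb] at h1 h2
    rw [h1, h2, ih.1, ih.2]
    have ha' : (Real.cos (ϑ 0) : ℂ) * Real.cos (ϑ 1) = a := by rw [ha]; push_cast; rfl
    rw [ha', ← hcos]
    have hc : Real.cos ((n + 1 : ℕ) * ω) = Real.cos (n * ω) * Real.cos ω
        - Real.sin (n * ω) * Real.sin ω := by rw [← Real.cos_add]; push_cast; ring_nf
    have hs' : Real.sin ((n + 1 : ℕ) * ω) = Real.sin (n * ω) * Real.cos ω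
        + Real.cos (n * ω) * Real.sin ω := by rw [← Real.sin_add]; push_cast; ring_nf
    rw [hc, hs']
    simp only [map_mul, map_add, map_neg, map_div₀, conj_ofReal, conj_I, ofReal_mul, ofReal_add,
      ofReal_sub, ofReal_div, ofReal_neg]
    generalize (Real.cos ω : ℂ) = C at *
    generalize (Real.sin ω : ℂ) = S at *
    generalize (Real.cos (n * ω) : ℂ) = Cn at *
    generalize (Real.sin (n * ω) : ℂ) = Sn at *
    generalize offDiag (ϑ 0) (ϑ 1) k = q at *
    generalize (Real.sin (2 * k) : ℂ) = v at *
    constructor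
    · field_simp
      linear_combination (-Sn) * hN' + Sn * hT + (a : ℂ) ^ 2 * v ^ 2 * Sn * I_sq
    · field_simp
      ring

end TwoPeriod

/-- The last coin can be split off. -/
theorem symbol_succ_eq (ϑ : ℕ → ℝ) (k : ℝ) (t : ℕ) :
    (symbol ϑ k (t + 1)).1
        = exp (-(k * I)) * Real.cos (ϑ 0) * (symbol (fun s => ϑ (s + 1)) k t).1
          - exp (k * I) * Real.sin (ϑ 0) * (symbol (fun s => ϑ (s + 1)) k t).2 ∧
      (symbol ϑ k (t + 1)).2
        = exp (-(k * I)) * Real.sin (ϑ 0) * (symbol (fun s => ϑ (s + 1)) k t).1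
          + exp (k * I) * Real.cos (ϑ 0) * (symbol (fun s => ϑ (s + 1)) k t).2 := by
  induction t with
  | zero => simp [symbol]
  | succ t ih =>
    rw [symbol, ih.1, ih.2]
    simp only [symbol, map_mul, map_add, map_sub, conj_ofReal, ← exp_conj, map_neg, conj_I,
      mul_neg, neg_neg]
    constructor <;> ring

/-- The coin split off is a rotation independent of the momentum and cancels in the overlap. The
remaining phases tend to 1 as `l - k → 0`, which reduces odd times to even ones. -/
theorem overlap_succ_eq (ϑ : ℕ → ℝ) (k l : ℝ) (t : ℕ) :
    overlap ϑ (t + 1) k l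
      = exp (-((l - k : ℝ) * I)) * (conj (symbol (fun s => ϑ (s + 1)) k t).1
          * (symbol (fun s => ϑ (s + 1)) l t).1)
        + exp ((l - k : ℝ) * I) * (conj (symbol (fun s => ϑ (s + 1)) k t).2
          * (symbol (fun s => ϑ (s + 1)) l t).2) := by
  have e1 : exp (-((l - k : ℝ) * I)) = exp (k * I) * exp (-(l * I)) := by
    rw [← exp_add]; push_cast; ring_nf
  have e2 : exp ((l - k : ℝ) * I) = exp (-(k * I)) * exp (l * I) := by
    rw [← exp_add]; push_cast; ring_nf
  have h2 : (Real.sin (ϑ 0) : ℂ) ^ 2 + (Real.cos (ϑ 0) : ℂ) ^ 2 = 1 := by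
    exact_mod_cast congrArg ((↑) : ℝ → ℂ) (Real.sin_sq_add_cos_sq (ϑ 0))
  rw [overlap, (symbol_succ_eq ϑ k t).1, (symbol_succ_eq ϑ k t).2, (symbol_succ_eq ϑ l t).1,
    (symbol_succ_eq ϑ l t).2, e1, e2]
  simp only [map_mul, map_add, map_sub, conj_ofReal, ← exp_conj, map_neg, conj_I, mul_neg, neg_neg]
  linear_combination (exp (k * I) * exp (-(l * I)) * (conj (symbol (fun s => ϑ (s + 1)) k t).1
          * (symbol (fun s => ϑ (s + 1)) l t).1)
        + exp (-(k * I)) * exp (l * I) * (conj (symbol (fun s => ϑ (s + 1)) k t).2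
          * (symbol (fun s => ϑ (s + 1)) l t).2)) * h2

theorem norm_overlap_le (ϑ : ℕ → ℝ) (t : ℕ) (k l : ℝ) : ‖overlap ϑ t k l‖ ≤ 2 := by
  unfold overlap
  refine (norm_add_le _ _).trans ?_
  simp only [norm_mul, norm_conj]
  have h1 := norm_symbol_le ϑ k t
  have h2 := norm_symbol_le ϑ l t
  have := mul_le_one₀ h1.1 (norm_nonneg _) h2.1
  have := mul_le_one₀ h1.2 (norm_nonneg _) h2.2
  linarith

theorem continuous_cosEnergy (a b : ℝ) : Continuous (cosEnergy a b) := by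
  unfold cosEnergy; fun_prop

theorem tendsto_symbol_overlap {ϑ : ℕ → ℝ} (hϑ : ∀ t, ϑ (t + 2) = ϑ t)
    (h0 : Real.cos (ϑ 0) ≠ 0) (h1 : Real.cos (ϑ 1) ≠ 0) {a b k η : ℝ}
    (ha : a = Real.cos (ϑ 0) * Real.cos (ϑ 1)) (hb : b = Real.sin (ϑ 0) * Real.sin (ϑ 1))
    (hk : Real.sin (2 * k) ≠ 0)
    {u : ℕ → ℝ} (hu : Tendsto u atTop (𝓝 k))
    (hη : Tendsto (fun n : ℕ => n * (u n - k)) atTop (𝓝 (η / 2)))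
    {e f : ℕ → ℂ} (he : Tendsto e atTop (𝓝 1)) (hf : Tendsto f atTop (𝓝 1)) :
    Tendsto (fun n : ℕ =>
      e n * (conj (symbol ϑ k (2 * n)).1 * (symbol ϑ (u n) (2 * n)).1)
        + f n * (conj (symbol ϑ k (2 * n)).2 * (symbol ϑ (u n) (2 * n)).2))
      atTop (𝓝 (Real.cos (η * velocity a b k)
        - I * velocity a b k * Real.sin (η * velocity a b k))) := by
  have hlt : cosEnergy a b k ^ 2 < 1 := by rw [ha, hb]; exact sq_cosEnergy_lt_one h0 h1 hk
  have hcont := continuous_cosEnergy a b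
  have hev : ∀ᶠ n in atTop, cosEnergy a b (u n) ^ 2 < 1 :=
    (((hcont.pow 2).tendsto k).comp hu).eventually_lt_const hlt
  have hpos : 0 < Real.sqrt (1 - cosEnergy a b k ^ 2) := Real.sqrt_pos.2 (by linarith)
  -- The factor 2 appears because the quasi-energy belongs to two steps; it cancels the 2 in `η /
  -- 2`.
  have hder : HasDerivAt (fun l => Real.arccos (cosEnergy a b l)) (-(2 * velocity a b k)) k := by
    have hg : HasDerivAt (cosEnergy a b) (-(2 * a * Real.sin (2 * k))) k := by
      have := (((hasDerivAt_id k).const_mul 2).cos.const_mul a).sub_const b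
      convert! this using 1
      simp; ring
    have := (Real.hasDerivAt_arccos (x := cosEnergy a b k) (by nlinarith) (by nlinarith)).comp k hg
    convert! this using 1
    rw [velocity]; field_simp
  have hsq : Continuous fun l => Real.sqrt (1 - cosEnergy a b l ^ 2) := by fun_prop
  have hm : ContinuousAt (velocity a b) k := by
    unfold velocity
    exact ContinuousAt.div (by fun_prop) hsq.continuousAt hpos.ne'
  have hr : ContinuousAt
      (fun l => offDiag (ϑ 0) (ϑ 1) l / Real.sqrt (1 - cosEnergy a b l ^ 2)) k := by
    refine ContinuousAt.div ?_ (continuous_ofReal.comp hsq).continuousAt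
      (by exact_mod_cast hpos.ne')
    unfold offDiag; fun_prop
  have hone : (velocity a b k : ℂ) ^ 2 +
      conj (offDiag (ϑ 0) (ϑ 1) k / Real.sqrt (1 - cosEnergy a b k ^ 2))
        * (offDiag (ϑ 0) (ϑ 1) k / Real.sqrt (1 - cosEnergy a b k ^ 2)) = 1 := by
    rw [conj_mul', norm_div, norm_real, Real.norm_of_nonneg hpos.le]
    have hN := normSq_two_step (ϑ 0) (ϑ 1) k
    rw [← ha, ← hb] at hN
    have hss := Real.sq_sqrt (show 0 ≤ 1 - cosEnergy a b k ^ 2 by linarith)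
    norm_cast
    rw [velocity, div_pow, div_pow, ← normSq_eq_norm_sq, ← add_div,
      div_eq_one_iff_eq (by positivity), hss]
    linarith
  have key := tendsto_rotation_overlap hder hm hr hone hu hη he hf
  have e1 : η / 2 * -(2 * velocity a b k) = -(η * velocity a b k) := by ring
  rw [e1, Real.cos_neg, Real.sin_neg] at key
  have e2 : (Real.cos (η * velocity a b k) : ℂ)
        + I * velocity a b k * (-Real.sin (η * velocity a b k) : ℝ)
      = Real.cos (η * velocity a b k) - I * velocity a b k * Real.sin (η * velocity a b k) := by
    push_cast; ring
  rw [e2] at key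
  refine key.congr' ?_
  filter_upwards [hev] with n hn
  have s1 := symbol_even hϑ ha hb rfl hlt n
  have s2 := symbol_even hϑ ha hb rfl hn n
  rw [s1.1, s1.2, s2.1, s2.2]

theorem tendsto_overlap {ϑ : ℕ → ℝ} (hϑ : ∀ t, ϑ (t + 2) = ϑ t)
    (h0 : Real.cos (ϑ 0) ≠ 0) (h1 : Real.cos (ϑ 1) ≠ 0) {a b k : ℝ} (ζ : ℝ)
    (ha : a = Real.cos (ϑ 0) * Real.cos (ϑ 1)) (hb : b = Real.sin (ϑ 0) * Real.sin (ϑ 1))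
    (hk : Real.sin (2 * k) ≠ 0) :
    Tendsto (fun t : ℕ => overlap ϑ t k (k + ζ / t)) atTop
      (𝓝 (Real.cos (ζ * velocity a b k)
        - I * velocity a b k * Real.sin (ζ * velocity a b k))) := by
  have hdiv : Tendsto (fun t : ℕ => ζ / t) atTop (𝓝 0) := tendsto_const_div_atTop_nhds_zero_nat ζ
  have hev : Tendsto (fun n : ℕ => 2 * n) atTop atTop :=
    tendsto_id.const_mul_atTop' (by norm_num)
  have hod : Tendsto (fun n : ℕ => 2 * n + 1) atTop atTop := (tendsto_add_atTop_nat 1).comp hev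
  have hadd : ∀ {v : ℕ → ℝ}, Tendsto v atTop (𝓝 0) → Tendsto (fun n => k + v n) atTop (𝓝 k) := by
    intro v hv; simpa using hv.const_add k
  refine tendsto_atTop_of_even_of_odd ?_ ?_
  · have := tendsto_symbol_overlap hϑ h0 h1 (η := ζ) ha hb hk (hadd (hdiv.comp hev)) ?_
      (tendsto_const_nhds (x := (1 : ℂ))) (tendsto_const_nhds (x := (1 : ℂ)))
    · simpa only [overlap, one_mul, Function.comp] using this
    · refine tendsto_const_nhds.congr' ?_
      filter_upwards [eventually_gt_atTop 0] with n hn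
      have : (n : ℝ) ≠ 0 := by positivity
      simp; field_simp
  · simp_rw [overlap_succ_eq]
    have hexp : ∀ c : ℝ,
        Tendsto (fun n : ℕ => exp (c * (ζ / (2 * n + 1 : ℕ) : ℝ) * I)) atTop (𝓝 1) := by
      intro c
      have hc : Continuous fun y : ℝ => exp (c * y * I) := by fun_prop
      have := (hc.tendsto 0).comp (hdiv.comp hod)
      rwa [ofReal_zero, mul_zero, zero_mul, exp_zero] at this
    -- The shifted sequence exchanges the two coins, but `a` and `b` are symmetric in them, so the
    -- limit is the same as at even times.
    have := tendsto_symbol_overlap (ϑ := fun s => ϑ (s + 1)) (fun t => hϑ (t + 1)) h1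
      (by simpa [hϑ 0] using h0) (η := ζ) (a := a) (b := b) (by simp [hϑ 0, ha, mul_comm])
      (by simp [hϑ 0, hb, mul_comm]) hk (hadd (hdiv.comp hod)) ?_ (hexp (-1)) (hexp 1)
    · refine this.congr fun n => ?_
      simp only [Function.comp]
      push_cast
      ring_nf
    · have h2 : Tendsto (fun n : ℕ => ζ / 2 - (ζ / (2 * n + 1 : ℕ)) / 2) atTop
          (𝓝 (ζ / 2 - 0 / 2)) :=
        tendsto_const_nhds.sub ((hdiv.comp hod).div_const 2)
      simp only [zero_div, sub_zero] at h2
      refine h2.congr fun n => ?_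
      simp only [Function.comp]
      have : (2 * (n : ℝ) + 1) ≠ 0 := by positivity
      push_cast
      field_simp
      ring

theorem ae_sin_two_mul_ne_zero : ∀ᵐ k : ℝ, Real.sin (2 * k) ≠ 0 := by
  have : {k : ℝ | Real.sin (2 * k) = 0} ⊆ Set.range fun n : ℤ => n * Real.pi / 2 := by
    intro k hk
    obtain ⟨n, hn⟩ := Real.sin_eq_zero_iff.1 hk
    exact ⟨n, by simp only [hn]; ring⟩
  have h := ((Set.countable_range fun n : ℤ => (n : ℝ) * Real.pi / 2).mono this).measure_zero volume
  filter_upwards [compl_mem_ae_iff.2 h] with k hk using hk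

theorem tendsto_charFun_rescaledLaw {ϑ : ℕ → ℝ} (hϑ : ∀ t, ϑ (t + 2) = ϑ t)
    (h0 : Real.cos (ϑ 0) ≠ 0) (h1 : Real.cos (ϑ 1) ≠ 0) {a b : ℝ} (ζ : ℝ)
    (ha : a = Real.cos (ϑ 0) * Real.cos (ϑ 1)) (hb : b = Real.sin (ϑ 0) * Real.sin (ϑ 1)) :
    Tendsto (fun t : ℕ => charFun (rescaledLaw ϑ t) ζ) atTop
      (𝓝 ((2 * Real.pi : ℂ)⁻¹ * ∫ k in (0 : ℝ)..(2 * Real.pi), (Real.cos (ζ * velocity a b k)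
        - I * velocity a b k * Real.sin (ζ * velocity a b k)))) := by
  simp_rw [charFun_rescaledLaw]
  refine Tendsto.const_mul _ ?_
  refine intervalIntegral.tendsto_integral_filter_of_dominated_convergence (fun _ => 2) ?_ ?_ ?_ ?_
  · refine Eventually.of_forall fun t => Continuous.aestronglyMeasurable ?_
    have c1 := (continuous_symbol ϑ t).fst
    have c2 := (continuous_symbol ϑ t).snd
    have ca : Continuous fun k : ℝ => k + ζ / t := by fun_prop
    exact ((continuous_conj.comp c1).mul (c1.comp ca)).add
      ((continuous_conj.comp c2).mul (c2.comp ca))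
  · exact Eventually.of_forall fun t => Eventually.of_forall fun k _ => norm_overlap_le _ _ _ _
  · simp
  · filter_upwards [ae_sin_two_mul_ne_zero] with k hk _
    exact tendsto_overlap hϑ h0 h1 ζ ha hb hk

/-! ### The limit density and its primitive -/

/-- Up to the factor `2 / π`, the distribution function belonging to `densityTotal`. -/
noncomputable def limitAngle (φ y : ℝ) : ℝ :=
  Real.arcsin (|Real.sin φ| * y / (|Real.cos φ| * Real.sqrt (1 - y ^ 2)))

section LimitAngle

variable {φ y : ℝ}

theorem abs_cos_lt_one_of_sin_ne_zero (hs : Real.sin φ ≠ 0) : |Real.cos φ| < 1 := by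
  rw [← sq_lt_one_iff_abs_lt_one]
  have := Real.sin_sq_add_cos_sq φ
  have : 0 < Real.sin φ ^ 2 := by positivity
  linarith

/-- This is the squared cosine of `limitAngle` in the relevant range; it enters both the derivative
of the arcsine and the radius in `lt_speed_iff`. -/
theorem sq_sin_limitAngle_arg (hc : Real.cos φ ≠ 0) (hy : y ^ 2 < 1) :
    1 - (|Real.sin φ| * y / (|Real.cos φ| * Real.sqrt (1 - y ^ 2))) ^ 2
      = (Real.cos φ ^ 2 - y ^ 2) / (Real.cos φ ^ 2 * (1 - y ^ 2)) := by
  have h1 : (1 - y ^ 2) ≠ 0 := by linarith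
  rw [div_pow, mul_pow, mul_pow, sq_abs, sq_abs, Real.sq_sqrt (by linarith)]
  have := Real.sin_sq_add_cos_sq φ
  field_simp
  linear_combination (-y ^ 2) * this

theorem limitAngle_mem (hy : 0 ≤ y) : limitAngle φ y ∈ Set.Icc 0 (Real.pi / 2) :=
  ⟨Real.arcsin_nonneg.2 (by positivity), Real.arcsin_le_pi_div_two _⟩

theorem sin_limitAngle (hc : Real.cos φ ≠ 0) (hs : Real.sin φ ≠ 0) (hy : 0 ≤ y)
    (hyc : y ≤ |Real.cos φ|) :
    Real.sin (limitAngle φ y) = |Real.sin φ| * y / (|Real.cos φ| * Real.sqrt (1 - y ^ 2)) := by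
  have h1 := abs_cos_lt_one_of_sin_ne_zero hs
  have hy1 : y ^ 2 < 1 := by nlinarith
  have h2 := sq_sin_limitAngle_arg hc hy1
  have h3 : 0 ≤ (Real.cos φ ^ 2 - y ^ 2) / (Real.cos φ ^ 2 * (1 - y ^ 2)) :=
    div_nonneg (by rw [← sq_abs (Real.cos φ)]; nlinarith)
      (mul_nonneg (sq_nonneg _) (by linarith))
  rw [← h2] at h3
  have h4 := abs_le.1 ((sq_le_one_iff_abs_le_one _).1 (sub_nonneg.1 h3))
  exact Real.sin_arcsin h4.1 h4.2

theorem limitAngle_zero : limitAngle φ 0 = 0 := by simp [limitAngle]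

theorem limitAngle_abs_cos (hc : Real.cos φ ≠ 0) (hs : Real.sin φ ≠ 0) :
    limitAngle φ |Real.cos φ| = Real.pi / 2 := by
  have : Real.sqrt (1 - |Real.cos φ| ^ 2) = |Real.sin φ| := by
    rw [sq_abs, ← Real.sqrt_sq_eq_abs]; congr 1; linarith [Real.sin_sq_add_cos_sq φ]
  rw [limitAngle, this, mul_comm, div_self (by positivity), Real.arcsin_one]

theorem hasDerivAt_limitAngle (hc : Real.cos φ ≠ 0) (hs : Real.sin φ ≠ 0)
    (hy : y ∈ Set.Ioo 0 |Real.cos φ|) :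
    HasDerivAt (fun z => 2 / Real.pi * limitAngle φ z)
      (2 * |Real.sin φ| / (Real.pi * (1 - y ^ 2) * Real.sqrt (Real.cos φ ^ 2 - y ^ 2))) y := by
  obtain ⟨hy0, hyc⟩ := hy
  have h1 := abs_cos_lt_one_of_sin_ne_zero hs
  have hy1 : y ^ 2 < 1 := by nlinarith
  have h2 := sq_sin_limitAngle_arg hc hy1
  have hcy : 0 < Real.cos φ ^ 2 - y ^ 2 := by rw [← sq_abs (Real.cos φ)]; nlinarith
  have hpos : 0 < 1 - y ^ 2 := by linarith
  have h3 : 0 < (Real.cos φ ^ 2 - y ^ 2) / (Real.cos φ ^ 2 * (1 - y ^ 2)) := by positivity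
  have h4 := h3
  rw [← h2] at h4
  have h5 := abs_lt.1 ((sq_lt_one_iff_abs_lt_one _).1 (sub_pos.1 h4))
  have hq : 0 < Real.sqrt (1 - y ^ 2) := Real.sqrt_pos.2 hpos
  have hca : 0 < |Real.cos φ| := by positivity
  have hin : HasDerivAt (fun z => |Real.sin φ| * z / (|Real.cos φ| * Real.sqrt (1 - z ^ 2)))
      (|Real.sin φ| / (|Real.cos φ| * ((1 - y ^ 2) * Real.sqrt (1 - y ^ 2)))) y := by
    have hs1 : HasDerivAt (fun z : ℝ => 1 - z ^ 2) (-(2 * y)) y := by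
      simpa using ((hasDerivAt_id y).pow 2).const_sub 1
    have := ((hasDerivAt_id y).const_mul |Real.sin φ|).div
      ((hs1.sqrt hpos.ne').const_mul |Real.cos φ|)
      (by positivity)
    convert! this using 1
    have hsq := Real.sq_sqrt hpos.le
    generalize Real.sqrt (1 - y ^ 2) = q at *
    simp only [id]
    rw [← hsq]
    field_simp
    linear_combination -hsq
  have := ((Real.hasDerivAt_arcsin h5.1.ne' h5.2.ne).comp y hin).const_mul (2 / Real.pi)
  convert! this using 1
  rw [h2, Real.sqrt_div hcy.le, Real.sqrt_mul (sq_nonneg _), Real.sqrt_sq_eq_abs]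
  have := Real.sqrt_pos.2 hcy
  field_simp

theorem continuousOn_limitAngle (hc : Real.cos φ ≠ 0) (hs : Real.sin φ ≠ 0) :
    ContinuousOn (fun z => 2 / Real.pi * limitAngle φ z) (Set.Icc 0 |Real.cos φ|) := by
  have h1 := abs_cos_lt_one_of_sin_ne_zero hs
  refine continuousOn_const.mul (Real.continuous_arcsin.comp_continuousOn ?_)
  refine ContinuousOn.div (by fun_prop) (by fun_prop) fun z hz => ?_
  have : 0 < 1 - z ^ 2 := by nlinarith [hz.1, hz.2]
  have := Real.sqrt_pos.2 this
  positivity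

end LimitAngle

section Density

variable {φ : ℝ}

theorem densityTotal_nonneg (hs : Real.sin φ ≠ 0) (y : ℝ) : 0 ≤ densityTotal φ y := by
  have h1 := abs_cos_lt_one_of_sin_ne_zero hs
  refine Set.indicator_nonneg (fun z hz => ?_) y
  have : 0 ≤ 1 - z ^ 2 := by nlinarith [hz.1, hz.2]
  have := Real.pi_pos
  positivity

/-- The singularity at `|cos φ|` needs no estimate: a nonnegative derivative of a function
continuous up to the endpoints is integrable. -/
theorem integrableOn_densityTotal_aux (hc : Real.cos φ ≠ 0) (hs : Real.sin φ ≠ 0) :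
    IntegrableOn (fun y => 2 * |Real.sin φ| /
      (Real.pi * (1 - y ^ 2) * Real.sqrt (Real.cos φ ^ 2 - y ^ 2))) (Set.Ioc 0 |Real.cos φ|) := by
  have h1 := abs_cos_lt_one_of_sin_ne_zero hs
  refine intervalIntegral.integrableOn_deriv_of_nonneg (continuousOn_limitAngle hc hs)
    (fun y hy => hasDerivAt_limitAngle hc hs hy) fun z hz => ?_
  have : 0 ≤ 1 - z ^ 2 := by nlinarith [hz.1, hz.2]
  have := Real.pi_pos
  positivity

theorem integrable_densityTotal (hc : Real.cos φ ≠ 0) (hs : Real.sin φ ≠ 0) :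
    Integrable (densityTotal φ) := by
  rw [densityTotal, integrable_indicator_iff measurableSet_Ico,
    integrableOn_congr_set_ae Ico_ae_eq_Ioc]
  exact integrableOn_densityTotal_aux hc hs

theorem setIntegral_densityTotal (hc : Real.cos φ ≠ 0) (hs : Real.sin φ ≠ 0) {y : ℝ}
    (hy : 0 ≤ y) :
    ∫ z in Set.Iic y, densityTotal φ z = 2 / Real.pi * limitAngle φ (min y |Real.cos φ|) := by
  have hm : 0 ≤ min y |Real.cos φ| := le_min hy (abs_nonneg _)
  have hset : (Set.Iic y ∩ Set.Ico 0 |Real.cos φ| : Set ℝ) =ᵐ[volume]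
      Set.Ioc 0 (min y |Real.cos φ|) := by
    have h1 : (Set.Iic y ∩ Set.Ico 0 |Real.cos φ| : Set ℝ) =ᵐ[volume]
        (Set.Iic y ∩ Set.Ioc 0 |Real.cos φ| : Set ℝ) :=
      (ae_eq_refl _).inter Ico_ae_eq_Ioc
    rw [Set.inter_comm (Set.Iic y) (Set.Ioc _ _), Set.Ioc_inter_Iic, min_comm] at h1
    exact h1
  rw [densityTotal, setIntegral_indicator measurableSet_Ico, setIntegral_congr_set hset,
    ← intervalIntegral.integral_of_le hm]
  have hsub : Set.Icc 0 (min y |Real.cos φ|) ⊆ Set.Icc 0 |Real.cos φ| :=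
    Set.Icc_subset_Icc_right (min_le_right _ _)
  rw [intervalIntegral.integral_eq_sub_of_hasDerivAt_of_le hm
    ((continuousOn_limitAngle hc hs).mono hsub)
    (fun z hz => hasDerivAt_limitAngle hc hs ⟨hz.1, hz.2.trans_le (min_le_right _ _)⟩)]
  · simp [limitAngle_zero]
  · rw [intervalIntegrable_iff_integrableOn_Ioc_of_le hm]
    exact (integrableOn_densityTotal_aux hc hs).mono_set
      (Set.Ioc_subset_Ioc_right (min_le_right _ _))

theorem setIntegral_densityTotal_of_neg {y : ℝ} (hy : y < 0) :
    ∫ z in Set.Iic y, densityTotal φ z = 0 := by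
  refine setIntegral_eq_zero_of_forall_eq_zero fun z hz => Set.indicator_of_notMem ?_ _
  exact fun h => absurd (h.1.trans hz) (not_le.2 hy)

theorem integral_densityTotal (hc : Real.cos φ ≠ 0) (hs : Real.sin φ ≠ 0) :
    ∫ z, densityTotal φ z = 1 := by
  have h := setIntegral_densityTotal hc hs (abs_nonneg (Real.cos φ))
  rw [min_self, limitAngle_abs_cos hc hs] at h
  rw [← setIntegral_eq_integral_of_forall_compl_eq_zero (s := Set.Iic |Real.cos φ|), h]
  · field_simp
  · intro z hz
    exact Set.indicator_of_notMem (fun h => hz h.2.le) _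

end Density

/-! ### The law of the group velocity -/

section Speed

variable {φ ψ : ℝ}

/-- The modulus of the velocity. -/
noncomputable def speed (φ ψ κ : ℝ) : ℝ :=
  |Real.cos φ * Real.cos ψ * Real.sin κ| /
    Real.sqrt (1 - (Real.cos φ * Real.cos ψ * Real.cos κ - Real.sin φ * Real.sin ψ) ^ 2)

theorem abs_velocity_eq (φ ψ k : ℝ) :
    |velocity (Real.cos φ * Real.cos ψ) (Real.sin φ * Real.sin ψ) k| = speed φ ψ (2 * k) := by
  rw [velocity, speed, abs_div, abs_neg, cosEnergy, abs_of_nonneg (Real.sqrt_nonneg _)]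

theorem speed_nonneg (φ ψ κ : ℝ) : 0 ≤ speed φ ψ κ := by unfold speed; positivity

theorem measurable_speed (φ ψ : ℝ) : Measurable (speed φ ψ) := by
  unfold speed
  exact Measurable.div (Continuous.measurable (by fun_prop)) (Continuous.measurable (by fun_prop))

theorem speed_le_abs_cos (φ ψ κ : ℝ) : speed φ ψ κ ≤ |Real.cos φ| := by
  refine div_le_of_le_mul₀ (Real.sqrt_nonneg _) (abs_nonneg _) ?_
  have h1 := Real.sin_sq_add_cos_sq φ
  have h2 := Real.sin_sq_add_cos_sq ψ
  have h3 := Real.sin_sq_add_cos_sq κ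
  -- As a sum of two squares, the radicand is at least `(cos ψ sin κ) ^ 2`, leaving only `|cos φ|`
  -- in the quotient.
  have e : 1 - (Real.cos φ * Real.cos ψ * Real.cos κ - Real.sin φ * Real.sin ψ) ^ 2
      = (Real.cos ψ * Real.sin κ) ^ 2
        + (Real.cos ψ * Real.sin φ * Real.cos κ + Real.cos φ * Real.sin ψ) ^ 2 := by
    linear_combination (-(Real.cos ψ ^ 2 * Real.cos κ ^ 2 + Real.sin ψ ^ 2)) * h1
      - Real.cos ψ ^ 2 * h3 - h2
  rw [e, mul_assoc, abs_mul]
  exact mul_le_mul_of_nonneg_left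
    (Real.abs_le_sqrt (le_add_of_nonneg_right (sq_nonneg _))) (abs_nonneg _)

theorem one_sub_sq_pos (hφ : Real.cos φ ≠ 0) (hψ : Real.cos ψ ≠ 0) {κ : ℝ}
    (hκ : κ ∈ Set.Ioo 0 Real.pi) :
    0 < 1 - (Real.cos φ * Real.cos ψ * Real.cos κ - Real.sin φ * Real.sin ψ) ^ 2 := by
  have e : 2 * (κ / 2) = κ := by ring
  have := sq_cosEnergy_lt_one hφ hψ (k := κ / 2)
    (by rw [e]; exact (Real.sin_pos_of_mem_Ioo hκ).ne')
  rw [cosEnergy, e] at this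
  linarith

/-- Squaring gives a quadratic inequality in `cos κ`. After completing the square, the squared
radius factors into one term per coin. -/
theorem lt_speed_iff (hφ : Real.cos φ ≠ 0) (hψ : Real.cos ψ ≠ 0) (hφ' : Real.sin φ ≠ 0)
    (hψ' : Real.sin ψ ≠ 0) {y : ℝ} (hy : 0 ≤ y) (hyφ : y < |Real.cos φ|) (hyψ : y < |Real.cos ψ|)
    {κ : ℝ} (hκ : κ ∈ Set.Ioo 0 Real.pi) :
    y < speed φ ψ κ ↔
      |Real.cos κ + Real.sin φ * Real.sin ψ * y ^ 2 / (Real.cos φ * Real.cos ψ * (1 - y ^ 2))|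
        < Real.cos (limitAngle φ y) * Real.cos (limitAngle ψ y) := by
  have hy1 : y ^ 2 < 1 := by nlinarith [abs_cos_lt_one_of_sin_ne_zero hφ']
  have hD := one_sub_sq_pos hφ hψ hκ
  have hnn : ∀ ρ, 0 ≤ Real.cos (limitAngle ρ y) := fun ρ =>
    Real.cos_nonneg_of_mem_Icc ⟨by linarith [(limitAngle_mem (φ := ρ) hy).1, Real.pi_pos],
      (limitAngle_mem hy).2⟩
  have hcos : ∀ ρ, Real.cos ρ ≠ 0 → Real.sin ρ ≠ 0 → y < |Real.cos ρ| →
      Real.cos (limitAngle ρ y) ^ 2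
        = (Real.cos ρ ^ 2 - y ^ 2) / (Real.cos ρ ^ 2 * (1 - y ^ 2)) := by
    intro ρ h1 h2 h3
    rw [← sq_sin_limitAngle_arg h1 hy1, ← sin_limitAngle h1 h2 hy h3.le]
    linarith [Real.sin_sq_add_cos_sq (limitAngle ρ y)]
  rw [speed, lt_div_iff₀ (Real.sqrt_pos.2 hD), ← abs_of_nonneg (mul_nonneg hy (Real.sqrt_nonneg _)),
    ← sq_lt_sq, mul_pow, Real.sq_sqrt hD.le, ← abs_of_nonneg (mul_nonneg (hnn φ) (hnn ψ)),
    ← sq_lt_sq, mul_pow (Real.cos (limitAngle φ y)), hcos φ hφ hφ' hyφ, hcos ψ hψ hψ' hyψ,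
    ← sub_neg, ← sub_neg (b := _ * _)]
  have hpos : 0 < (Real.cos φ * Real.cos ψ) ^ 2 * (1 - y ^ 2) :=
    mul_pos (by positivity) (by linarith)
  have h1 := Real.sin_sq_add_cos_sq φ
  have h2 := Real.sin_sq_add_cos_sq ψ
  have h3 := Real.sin_sq_add_cos_sq κ
  have hy2 : 1 - y ^ 2 ≠ 0 := by linarith
  have hneg := fun z : ℝ => mul_lt_mul_iff_right₀ (b := z) (c := 0) hpos
  simp only [mul_zero] at hneg
  rw [← hneg (_ ^ 2 - _ * _)]
  refine iff_of_eq (congrArg (· < 0) ?_)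
  field_simp
  linear_combination (-(1 - y ^ 2) * Real.cos φ ^ 2 * Real.cos ψ ^ 2) * h3
    - y ^ 2 * Real.sin ψ ^ 2 * h1 - y ^ 2 * (1 - Real.cos φ ^ 2) * h2

/-- By the addition theorems the set is `(A + B, π - |A - B|)` or `(|A - B|, π - (A + B))`,
according to the sign of `σ`. Both have the same length, since `A + B + |A - B| = 2 * max A B`. -/
theorem measure_Ioo_inter_abs_cos_lt {A B σ : ℝ} (hA : A ∈ Set.Icc 0 (Real.pi / 2))
    (hB : B ∈ Set.Icc 0 (Real.pi / 2)) (hσ : |σ| = Real.sin A * Real.sin B) :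
    volume (Set.Ioo 0 Real.pi ∩ {κ | |Real.cos κ + σ| < Real.cos A * Real.cos B})
      = ENNReal.ofReal (Real.pi - 2 * max A B) := by
  have hpi := Real.pi_pos
  obtain ⟨hA0, hA1⟩ := hA
  obtain ⟨hB0, hB1⟩ := hB
  have hd : |A - B| ≤ A + B := abs_le.2 ⟨by linarith, by linarith⟩
  have hmax : 2 * max A B = A + B + |A - B| := by
    rcases le_total A B with h | h
    · rw [max_eq_right h, abs_of_nonpos (by linarith)]; ring
    · rw [max_eq_left h, abs_of_nonneg (by linarith)]; ring
  have key : ∀ lo hi : ℝ, 0 ≤ lo → lo ≤ Real.pi → 0 ≤ hi → hi ≤ Real.pi →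
      Real.cos lo = Real.cos A * Real.cos B - σ →
      Real.cos hi = -(Real.cos A * Real.cos B) - σ →
      Set.Ioo 0 Real.pi ∩ {κ | |Real.cos κ + σ| < Real.cos A * Real.cos B} = Set.Ioo lo hi := by
    intro lo hi h0 h1 h2 h3 e1 e2
    ext κ
    simp only [Set.mem_inter_iff, Set.mem_Ioo, Set.mem_ofPred_eq, abs_lt]
    have a1 : 0 ≤ κ → κ ≤ Real.pi → (Real.cos κ < Real.cos lo ↔ lo < κ) := fun p q =>
      Real.strictAntiOn_cos.lt_iff_gt ⟨p, q⟩ ⟨h0, h1⟩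
    have a2 : 0 ≤ κ → κ ≤ Real.pi → (Real.cos hi < Real.cos κ ↔ κ < hi) := fun p q =>
      Real.strictAntiOn_cos.lt_iff_gt ⟨h2, h3⟩ ⟨p, q⟩
    constructor
    · rintro ⟨⟨p, q⟩, h4, h5⟩
      exact ⟨(a1 p.le q.le).1 (by linarith), (a2 p.le q.le).1 (by linarith)⟩
    · rintro ⟨h4, h5⟩
      have p : 0 < κ := by linarith
      have q : κ < Real.pi := by linarith
      have := (a1 p.le q.le).2 h4
      have := (a2 p.le q.le).2 h5
      exact ⟨⟨p, q⟩, by linarith, by linarith⟩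
  have hs : 0 ≤ Real.sin A * Real.sin B := mul_nonneg
    (Real.sin_nonneg_of_nonneg_of_le_pi hA0 (by linarith))
    (Real.sin_nonneg_of_nonneg_of_le_pi hB0 (by linarith))
  rcases (abs_eq hs).1 hσ with h | h
  · rw [key (A + B) (Real.pi - |A - B|) (by linarith) (by linarith) (by linarith)
      (by linarith [abs_nonneg (A - B)]) (by rw [Real.cos_add, h])
      (by rw [Real.cos_pi_sub, Real.cos_abs, Real.cos_sub, h]; ring), Real.volume_Ioo, hmax]
    ring_nf
  · rw [key |A - B| (Real.pi - (A + B)) (abs_nonneg _) (by linarith) (by linarith)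
      (by linarith) (by rw [Real.cos_abs, Real.cos_sub, h]; ring)
      (by rw [Real.cos_pi_sub, Real.cos_add, h]; ring), Real.volume_Ioo, hmax]
    ring_nf

/-- This decides the maximum of the two angles in favour of the coin with the smaller `|cos|`. -/
theorem limitAngle_le_of_abs_cos_le (hφ : Real.cos φ ≠ 0) {y : ℝ} (hy : 0 ≤ y)
    (h : |Real.cos φ| ≤ |Real.cos ψ|) : limitAngle ψ y ≤ limitAngle φ y := by
  refine Real.monotone_arcsin ?_
  have hcφ : 0 < |Real.cos φ| := abs_pos.2 hφ
  have hs : |Real.sin ψ| ≤ |Real.sin φ| := by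
    rw [← sq_le_sq] at h ⊢
    linarith [Real.sin_sq_add_cos_sq φ, Real.sin_sq_add_cos_sq ψ]
  rw [mul_div_mul_comm, mul_div_mul_comm]
  refine mul_le_mul_of_nonneg_right ?_ (by positivity)
  exact div_le_div₀ (abs_nonneg _) hs hcφ h

theorem volume_lt_speed (hφ : Real.cos φ ≠ 0) (hψ : Real.cos ψ ≠ 0) (hφ' : Real.sin φ ≠ 0)
    (hψ' : Real.sin ψ ≠ 0) (h : |Real.cos φ| ≤ |Real.cos ψ|) {y : ℝ} (hy : 0 ≤ y)
    (hyφ : y < |Real.cos φ|) :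
    volume (Set.Ioo 0 Real.pi ∩ {κ | y < speed φ ψ κ})
      = ENNReal.ofReal (Real.pi - 2 * limitAngle φ y) := by
  have hy1 : y ^ 2 < 1 := by nlinarith [abs_cos_lt_one_of_sin_ne_zero hφ']
  have hyψ := hyφ.trans_le h
  rw [← max_eq_left (limitAngle_le_of_abs_cos_le hφ hy h),
    ← measure_Ioo_inter_abs_cos_lt (limitAngle_mem hy) (limitAngle_mem hy)
      (σ := Real.sin φ * Real.sin ψ * y ^ 2 / (Real.cos φ * Real.cos ψ * (1 - y ^ 2)))]
  · congr 1
    ext κ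
    simp only [Set.mem_inter_iff, Set.mem_ofPred_eq]
    exact and_congr_right fun hκ => lt_speed_iff hφ hψ hφ' hψ' hy hyφ hyψ hκ
  · rw [sin_limitAngle hφ hφ' hy hyφ.le, sin_limitAngle hψ hψ' hy hyψ.le, div_mul_div_comm,
      abs_div, abs_mul, abs_mul, abs_mul, abs_mul, abs_of_nonneg (sq_nonneg y),
      abs_of_pos (show 0 < 1 - y ^ 2 by linarith)]
    have := Real.mul_self_sqrt (show 0 ≤ 1 - y ^ 2 by linarith)
    congr 1
    · ring
    · linear_combination (-|Real.cos φ| * |Real.cos ψ|) * this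

/-- The law of the speed for a uniformly distributed quasi-momentum. -/
theorem map_speed (hφ : Real.cos φ ≠ 0) (hψ : Real.cos ψ ≠ 0) (hφ' : Real.sin φ ≠ 0)
    (hψ' : Real.sin ψ ≠ 0) (h : |Real.cos φ| ≤ |Real.cos ψ|) :
    (ENNReal.ofReal Real.pi⁻¹ • volume.restrict (Set.Ioo 0 Real.pi)).map (speed φ ψ)
      = volume.withDensity fun y => ENNReal.ofReal (densityTotal φ y) := by
  have hpi := Real.pi_pos
  have hms := measurable_speed φ ψ
  set P := ENNReal.ofReal Real.pi⁻¹ • (volume : Measure ℝ).restrict (Set.Ioo 0 Real.pi) with hP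
  have hPP : IsProbabilityMeasure P := by
    constructor
    simp only [hP, Measure.smul_apply, Measure.restrict_apply_univ, Real.volume_Ioo, smul_eq_mul]
    rw [← ENNReal.ofReal_mul (by positivity), sub_zero, inv_mul_cancel₀ hpi.ne', ENNReal.ofReal_one]
  have hmap : IsProbabilityMeasure (P.map (speed φ ψ)) :=
    Measure.isProbabilityMeasure_map hms.aemeasurable
  refine Measure.ext_of_Iic _ _ fun y => ?_
  have hI : IntegrableOn (densityTotal φ) (Set.Iic y) :=
    (integrable_densityTotal hφ hφ').integrableOn
  rw [withDensity_apply _ measurableSet_Iic, ← ofReal_integral_eq_lintegral_ofReal hI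
    (Eventually.of_forall fun z => densityTotal_nonneg hφ' z)]
  rcases lt_or_ge y 0 with hy | hy
  · rw [setIntegral_densityTotal_of_neg hy, Measure.map_apply hms measurableSet_Iic]
    have : speed φ ψ ⁻¹' Set.Iic y = ∅ := by
      ext κ; simpa using hy.trans_le (speed_nonneg φ ψ κ)
    simp [this]
  · rw [setIntegral_densityTotal hφ hφ' hy, ← Set.compl_Ioi,
      prob_compl_eq_one_sub measurableSet_Ioi, Measure.map_apply hms measurableSet_Ioi]
    rcases lt_or_ge y |Real.cos φ| with hyφ | hyφ
    · have : P (speed φ ψ ⁻¹' Set.Ioi y)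
          = ENNReal.ofReal (Real.pi⁻¹ * (Real.pi - 2 * limitAngle φ y)) := by
        rw [hP, Measure.smul_apply, Measure.restrict_apply (hms measurableSet_Ioi), Set.inter_comm,
          smul_eq_mul, ENNReal.ofReal_mul (by positivity),
          ← volume_lt_speed hφ hψ hφ' hψ' h hy hyφ]
        rfl
      have hle : 0 ≤ Real.pi⁻¹ * (Real.pi - 2 * limitAngle φ y) :=
        mul_nonneg (by positivity) (by linarith [(limitAngle_mem (φ := φ) hy).2])
      rw [this, min_eq_left hyφ.le, ← ENNReal.ofReal_one, ← ENNReal.ofReal_sub _ hle]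
      congr 1
      field_simp
      ring
    · have : speed φ ψ ⁻¹' Set.Ioi y = ∅ := by
        ext κ; simpa using (speed_le_abs_cos φ ψ κ).trans hyφ
      rw [this, min_eq_right hyφ, limitAngle_abs_cos hφ hφ']
      simp

/-- The function whose mean with respect to `densityTotal` is the limiting characteristic
function. -/
noncomputable def charKernel (ζ y : ℝ) : ℂ := Real.cos (ζ * y) - I * y * Real.sin (ζ * y)

/-- Evenness lets the signed velocity be replaced by the speed. -/
theorem charKernel_abs (ζ y : ℝ) : charKernel ζ |y| = charKernel ζ y := by
  rcases abs_choice y with h | h <;> rw [h]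
  simp [charKernel]

theorem continuous_charKernel (ζ : ℝ) : Continuous (charKernel ζ) := by
  unfold charKernel; fun_prop

theorem norm_charKernel_le (ζ y : ℝ) : ‖charKernel ζ y‖ ≤ 1 + |y| := by
  unfold charKernel
  refine (norm_sub_le _ _).trans (add_le_add ?_ ?_)
  · rw [norm_real]; exact Real.abs_cos_le_one _
  · rw [norm_mul, norm_mul, norm_I, one_mul, norm_real, norm_real]
    exact mul_le_of_le_one_right (abs_nonneg _) (Real.abs_sin_le_one _)

/-- The integrand is a function of `κ = 2 * k` invariant under `κ ↦ 2π - κ` and `κ ↦ 4π - κ`. Its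
mean folds onto `(0, π)`, where `map_speed` applies. -/
theorem integral_charKernel_velocity (hφ : Real.cos φ ≠ 0) (hψ : Real.cos ψ ≠ 0)
    (hφ' : Real.sin φ ≠ 0) (hψ' : Real.sin ψ ≠ 0) (h : |Real.cos φ| ≤ |Real.cos ψ|) (ζ : ℝ) :
    (2 * Real.pi : ℂ)⁻¹ * ∫ k in (0 : ℝ)..(2 * Real.pi),
        charKernel ζ (velocity (Real.cos φ * Real.cos ψ) (Real.sin φ * Real.sin ψ) k)
      = ∫ y, densityTotal φ y * charKernel ζ y := by
  have hpi := Real.pi_pos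
  have hpc : (Real.pi : ℂ) ≠ 0 := by exact_mod_cast hpi.ne'
  set F : ℝ → ℂ := fun κ => charKernel ζ (speed φ ψ κ) with hF
  have hFm : Measurable F := (continuous_charKernel ζ).measurable.comp (measurable_speed φ ψ)
  have hFi : ∀ a b, IntervalIntegrable F volume a b := by
    intro a b
    refine (intervalIntegrable_const (c := (2 : ℝ))).mono_fun hFm.aestronglyMeasurable
      (Eventually.of_forall fun κ => ?_)
    refine (norm_charKernel_le _ _).trans ?_
    rw [abs_of_nonneg (speed_nonneg _ _ _)]
    have := speed_le_abs_cos φ ψ κ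
    have := Real.abs_cos_le_one φ
    norm_num
    linarith
  have hper : ∀ κ, F (2 * Real.pi - κ) = F κ := fun κ => by
    simp [hF, speed]
  have hper' : ∀ κ, F (4 * Real.pi - κ) = F κ := fun κ => by
    rw [show 4 * Real.pi - κ = 2 * Real.pi + (2 * Real.pi - κ) by ring]
    simp [hF, speed, add_comm (2 * Real.pi)]
  have i1 : ∫ κ in (2 * Real.pi)..(4 * Real.pi), F κ = ∫ κ in (0 : ℝ)..(2 * Real.pi), F κ := by
    have := intervalIntegral.integral_comp_sub_left F (4 * Real.pi) (a := 0) (b := 2 * Real.pi)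
    simp_rw [hper'] at this
    rw [this]; congr 1 <;> ring
  have i2 : ∫ κ in Real.pi..(2 * Real.pi), F κ = ∫ κ in (0 : ℝ)..Real.pi, F κ := by
    have := intervalIntegral.integral_comp_sub_left F (2 * Real.pi) (a := 0) (b := Real.pi)
    simp_rw [hper] at this
    rw [this]; congr 1 <;> ring
  have i3 : ∫ k in (0 : ℝ)..(2 * Real.pi), F (2 * k) = 2 * ∫ κ in (0 : ℝ)..Real.pi, F κ := by
    rw [intervalIntegral.integral_comp_mul_left F (by norm_num : (2 : ℝ) ≠ 0), mul_zero,
      show 2 * (2 * Real.pi) = 4 * Real.pi by ring,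
      ← intervalIntegral.integral_add_adjacent_intervals (hFi 0 (2 * Real.pi)) (hFi _ _), i1,
      ← intervalIntegral.integral_add_adjacent_intervals (hFi 0 Real.pi) (hFi _ _), i2, real_smul]
    push_cast; ring
  have e : ∀ k, charKernel ζ (velocity (Real.cos φ * Real.cos ψ) (Real.sin φ * Real.sin ψ) k)
      = F (2 * k) := fun k => by rw [hF, ← charKernel_abs, abs_velocity_eq]
  simp_rw [e]
  rw [i3, intervalIntegral.integral_of_le hpi.le, integral_Ioc_eq_integral_Ioo]
  have hD : ∫ y, densityTotal φ y * charKernel ζ y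
      = ∫ y, charKernel ζ y ∂(volume.withDensity fun y => ENNReal.ofReal (densityTotal φ y)) := by
    rw [integral_withDensity_eq_integral_toReal_smul₀]
    · refine integral_congr_ae (Eventually.of_forall fun y => ?_)
      simp only [ENNReal.toReal_ofReal (densityTotal_nonneg hφ' y), real_smul]
    · exact (integrable_densityTotal hφ hφ').aestronglyMeasurable.aemeasurable.ennreal_ofReal
    · exact Eventually.of_forall fun _ => ENNReal.ofReal_lt_top
  rw [hD, ← map_speed hφ hψ hφ' hψ' h, integral_map (measurable_speed φ ψ).aemeasurable
    (continuous_charKernel ζ).aestronglyMeasurable, integral_smul_measure,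
    ENNReal.toReal_ofReal (by positivity), real_smul]
  push_cast
  field_simp
  rfl

end Speed

/-! ### Splitting the density between the inner states -/

section Densities

variable {φ : ℝ}

theorem density₀_eq (hs : Real.sin φ ≠ 0) (y : ℝ) :
    density₀ φ y = (1 - y) / 2 * densityTotal φ y := by
  by_cases hy : y ∈ Set.Ico 0 |Real.cos φ|
  · have h1 := hy.2.trans (abs_cos_lt_one_of_sin_ne_zero hs)
    have h2 : 1 - y ≠ 0 := by linarith
    have h3 : 1 + y ≠ 0 := by linarith [hy.1]
    have h4 : 0 < Real.sqrt (Real.cos φ ^ 2 - y ^ 2) := by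
      rw [Real.sqrt_pos, sub_pos, ← sq_abs (Real.cos φ)]
      exact pow_lt_pow_left₀ hy.2 hy.1 two_ne_zero
    rw [density₀, densityTotal, Set.indicator_of_mem hy, Set.indicator_of_mem hy,
      show 1 - y ^ 2 = (1 - y) * (1 + y) by ring]
    field_simp
  · rw [density₀, densityTotal, Set.indicator_of_notMem hy, Set.indicator_of_notMem hy, mul_zero]

theorem density₁_eq (hs : Real.sin φ ≠ 0) (y : ℝ) :
    density₁ φ y = (1 + y) / 2 * densityTotal φ y := by
  by_cases hy : y ∈ Set.Ico 0 |Real.cos φ|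
  · have h1 := hy.2.trans (abs_cos_lt_one_of_sin_ne_zero hs)
    have h2 : 1 - y ≠ 0 := by linarith
    have h3 : 1 + y ≠ 0 := by linarith [hy.1]
    have h4 : 0 < Real.sqrt (Real.cos φ ^ 2 - y ^ 2) := by
      rw [Real.sqrt_pos, sub_pos, ← sq_abs (Real.cos φ)]
      exact pow_lt_pow_left₀ hy.2 hy.1 two_ne_zero
    rw [density₁, densityTotal, Set.indicator_of_mem hy, Set.indicator_of_mem hy,
      show 1 - y ^ 2 = (1 - y) * (1 + y) by ring]
    field_simp
  · rw [density₁, densityTotal, Set.indicator_of_notMem hy, Set.indicator_of_notMem hy, mul_zero]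

theorem densityTotal_eq_zero {y : ℝ} (hy : y ∉ Set.Ico 0 |Real.cos φ|) : densityTotal φ y = 0 :=
  Set.indicator_of_notMem hy _

theorem densityTotal_mul_bound (hs : Real.sin φ ≠ 0) {f : ℝ → ℝ}
    (hf : ∀ y ∈ Set.Ico (0 : ℝ) 1, 0 ≤ f y ∧ f y ≤ 1) (y : ℝ) :
    0 ≤ f y * densityTotal φ y ∧ f y * densityTotal φ y ≤ densityTotal φ y := by
  have h0 := densityTotal_nonneg hs y
  by_cases hy : y ∈ Set.Ico 0 |Real.cos φ|
  · have := hf y ⟨hy.1, hy.2.trans (abs_cos_lt_one_of_sin_ne_zero hs)⟩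
    exact ⟨mul_nonneg this.1 h0, mul_le_of_le_one_left h0 this.2⟩
  · simp [densityTotal_eq_zero hy]

theorem density₀_nonneg (hs : Real.sin φ ≠ 0) (y : ℝ) : 0 ≤ density₀ φ y := by
  rw [density₀_eq hs]
  exact (densityTotal_mul_bound hs (f := fun y => (1 - y) / 2)
    (fun y hy => ⟨by linarith [hy.2], by linarith [hy.1]⟩) y).1

theorem density₁_nonneg (hs : Real.sin φ ≠ 0) (y : ℝ) : 0 ≤ density₁ φ y := by
  rw [density₁_eq hs]
  exact (densityTotal_mul_bound hs (f := fun y => (1 + y) / 2)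
    (fun y hy => ⟨by linarith [hy.1], by linarith [hy.2]⟩) y).1

theorem integrable_mul_densityTotal (hc : Real.cos φ ≠ 0) (hs : Real.sin φ ≠ 0) {f : ℝ → ℝ}
    (hfc : Continuous f) (hf : ∀ y ∈ Set.Ico (0 : ℝ) 1, 0 ≤ f y ∧ f y ≤ 1) :
    Integrable fun y => f y * densityTotal φ y := by
  have hi := integrable_densityTotal hc hs
  refine hi.mono (hfc.aestronglyMeasurable.mul hi.aestronglyMeasurable)
    (Eventually.of_forall fun y => ?_)
  have := densityTotal_mul_bound hs hf y
  rw [Real.norm_of_nonneg this.1, Real.norm_of_nonneg (densityTotal_nonneg hs y)]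
  exact this.2

theorem integrable_density₀ (hc : Real.cos φ ≠ 0) (hs : Real.sin φ ≠ 0) :
    Integrable (density₀ φ) := by
  rw [show density₀ φ = fun y => (1 - y) / 2 * densityTotal φ y from funext (density₀_eq hs)]
  exact integrable_mul_densityTotal hc hs (by fun_prop)
    fun y hy => ⟨by linarith [hy.2], by linarith [hy.1]⟩

theorem integrable_density₁ (hc : Real.cos φ ≠ 0) (hs : Real.sin φ ≠ 0) :
    Integrable (density₁ φ) := by
  rw [show density₁ φ = fun y => (1 + y) / 2 * densityTotal φ y from funext (density₁_eq hs)]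
  exact integrable_mul_densityTotal hc hs (by fun_prop)
    fun y hy => ⟨by linarith [hy.1], by linarith [hy.2]⟩

theorem density₀_add_density₁ (hs : Real.sin φ ≠ 0) (y : ℝ) :
    density₀ φ y + density₁ φ y = densityTotal φ y := by
  rw [density₀_eq hs, density₁_eq hs]; ring

end Densities

/-! ### The two-sided limit law and weak convergence -/

section TwoSided

/-- The measure on `ℝ` with density `f` on the positive and `g (-·)` on the negative half line. -/
noncomputable def twoSided (f g : ℝ → ℝ) : Measure ℝ :=
  volume.withDensity (fun y => ENNReal.ofReal (f y)) +
    (volume.withDensity fun y => ENNReal.ofReal (g y)).map Neg.neg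

theorem map_neg_twoSided (f g : ℝ → ℝ) : (twoSided f g).map Neg.neg = twoSided g f := by
  rw [twoSided, Measure.map_add _ _ measurable_neg, Measure.map_map measurable_neg measurable_neg,
    show (Neg.neg ∘ Neg.neg : ℝ → ℝ) = id from funext neg_neg, Measure.map_id, add_comm, twoSided]

theorem twoSided_absolutelyContinuous (f g : ℝ → ℝ) : twoSided f g ≪ volume := by
  have h : (volume.withDensity fun y => ENNReal.ofReal (g y)).map Neg.neg ≪ volume := by
    have := (withDensity_absolutelyContinuous volume fun y => ENNReal.ofReal (g y)).map
      measurable_neg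
    rwa [(Measure.measurePreserving_neg (volume : Measure ℝ)).map_eq] at this
  exact Measure.AbsolutelyContinuous.add_left (withDensity_absolutelyContinuous _ _) h

variable {f g : ℝ → ℝ}

theorem isProbabilityMeasure_twoSided (hf : Integrable f) (hg : Integrable g) (hf0 : ∀ y, 0 ≤ f y)
    (hg0 : ∀ y, 0 ≤ g y) (h : ∫ y, f y + g y = 1) : IsProbabilityMeasure (twoSided f g) := by
  constructor
  rw [twoSided, Measure.add_apply, Measure.map_apply measurable_neg MeasurableSet.univ,
    Set.preimage_univ, withDensity_apply _ MeasurableSet.univ,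
    withDensity_apply _ MeasurableSet.univ, Measure.restrict_univ,
    ← ofReal_integral_eq_lintegral_ofReal hf (Eventually.of_forall hf0),
    ← ofReal_integral_eq_lintegral_ofReal hg (Eventually.of_forall hg0),
    ← ENNReal.ofReal_add (integral_nonneg hf0) (integral_nonneg hg0), ← integral_add hf hg, h,
    ENNReal.ofReal_one]

theorem twoSided_Icc (hf : Integrable f) (hf0 : ∀ y, 0 ≤ f y) (hf1 : ∀ y < 0, f y = 0)
    (hg1 : ∀ y < 0, g y = 0) {y : ℝ} (hy : 0 ≤ y) :
    (twoSided f g).real (Set.Icc 0 y) = ∫ z in Set.Iic y, f z := by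
  -- Without the null point 0, the reflected part only sees arguments where `g` vanishes.
  have e1 : (twoSided f g) (Set.Icc 0 y) = (twoSided f g) (Set.Ioc 0 y) :=
    measure_congr ((twoSided_absolutelyContinuous f g).ae_eq Ioc_ae_eq_Icc.symm)
  have e2 : (volume.withDensity fun y => ENNReal.ofReal (g y)).map Neg.neg (Set.Ioc 0 y) = 0 := by
    have hm : MeasurableSet (Neg.neg ⁻¹' Set.Ioc 0 y : Set ℝ) := measurable_neg measurableSet_Ioc
    rw [Measure.map_apply measurable_neg measurableSet_Ioc, withDensity_apply _ hm]
    refine (setLIntegral_congr_fun hm (g := fun _ => 0) fun z hz => ?_).trans (by simp)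
    simp only [Set.mem_preimage, Set.mem_Ioc] at hz
    simp [hg1 z (by linarith [hz.1])]
  have e3 : ∫ z in Set.Iic y, f z = ∫ z in Set.Ioc 0 y, f z := by
    have h1 : ∫ z in Set.Iic (0 : ℝ), f z = 0 := by
      rw [setIntegral_congr_set Iio_ae_eq_Iic.symm]
      exact setIntegral_eq_zero_of_forall_eq_zero fun z hz => hf1 z hz
    rw [← intervalIntegral.integral_of_le hy, ← intervalIntegral.integral_Iic_sub_Iic
      hf.integrableOn hf.integrableOn, h1, sub_zero]
  rw [measureReal_def, e1, twoSided, Measure.add_apply, e2, add_zero,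
    withDensity_apply _ measurableSet_Ioc, ← ofReal_integral_eq_lintegral_ofReal hf.integrableOn
      (Eventually.of_forall hf0), ENNReal.toReal_ofReal (integral_nonneg hf0), e3]

/-- Portmanteau: a convex set has Lebesgue-null frontier, so absolute continuity of the limit
suffices. -/
theorem tendsto_real_of_convex {M : ℕ → ProbabilityMeasure ℝ} {N : ProbabilityMeasure ℝ}
    (h : Tendsto M atTop (𝓝 N)) (hN : (N : Measure ℝ) ≪ volume) {s : Set ℝ} (hs : Convex ℝ s) :
    Tendsto (fun t => (M t : Measure ℝ).real s) atTop (𝓝 ((N : Measure ℝ).real s)) := by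
  have := ProbabilityMeasure.tendsto_measure_of_null_frontier_of_tendsto' h
    (hN (hs.addHaar_frontier volume))
  exact (ENNReal.tendsto_toReal (measure_ne_top _ _)).comp this

theorem charFun_twoSided (hf : Integrable f) (hg : Integrable g) (hf0 : ∀ y, 0 ≤ f y)
    (hg0 : ∀ y, 0 ≤ g y) [IsFiniteMeasure (twoSided f g)] (ζ : ℝ) :
    charFun (twoSided f g) ζ
      = ∫ y, (f y * exp (ζ * y * I) + g y * exp (-(ζ * y * I))) := by
  have hwd : ∀ {p : ℝ → ℝ} {G : ℝ → ℂ}, Integrable p → (∀ y, 0 ≤ p y) →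
      ∫ y, G y ∂(volume.withDensity fun y => ENNReal.ofReal (p y)) = ∫ y, p y * G y := by
    intro p G hp hp0
    rw [integral_withDensity_eq_integral_toReal_smul₀]
    · simp only [ENNReal.toReal_ofReal (hp0 _), real_smul]
    · exact hp.aestronglyMeasurable.aemeasurable.ennreal_ofReal
    · exact Eventually.of_forall fun _ => ENNReal.ofReal_lt_top
  have hn : ∀ y : ℝ, ‖exp (ζ * y * I)‖ = 1 := fun y => by
    rw [← ofReal_mul, norm_exp_ofReal_mul_I]
  have hi : ∀ {μ : Measure ℝ} [IsFiniteMeasure μ], Integrable (fun y : ℝ => exp (ζ * y * I)) μ := by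
    intro μ _
    exact Integrable.of_bound (Continuous.aestronglyMeasurable (by fun_prop)) 1
      (Eventually.of_forall fun y => (hn y).le)
  have hle : volume.withDensity (fun y => ENNReal.ofReal (f y)) ≤ twoSided f g :=
    Measure.le_add_right le_rfl
  have hle' : (volume.withDensity (fun y => ENNReal.ofReal (g y))).map Neg.neg ≤ twoSided f g :=
    Measure.le_add_left le_rfl
  have := isFiniteMeasure_of_le _ hle
  have := isFiniteMeasure_of_le _ hle'
  rw [charFun_apply_real, twoSided, integral_add_measure hi hi, hwd hf hf0,
    integral_map measurable_neg.aemeasurable (Continuous.aestronglyMeasurable (by fun_prop)),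
    hwd hg hg0, ← integral_add]
  · simp
  · refine hf.mono' ((continuous_ofReal.comp_aestronglyMeasurable hf.aestronglyMeasurable).mul
      (Continuous.aestronglyMeasurable (by fun_prop))) (Eventually.of_forall fun y => ?_)
    rw [norm_mul, hn, mul_one, norm_real, Real.norm_of_nonneg (hf0 y)]
  · refine hg.mono' ((continuous_ofReal.comp_aestronglyMeasurable hg.aestronglyMeasurable).mul
      (Continuous.aestronglyMeasurable (by fun_prop))) (Eventually.of_forall fun y => ?_)
    rw [norm_mul, hn, mul_one, norm_real, Real.norm_of_nonneg (hg0 y)]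

end TwoSided

/-- The two densities have sum `densityTotal` and difference `-y` times it; these are the
coefficients of `cos (ζ * y)` and `I * sin (ζ * y)`. -/
theorem charFun_limit {φ : ℝ} (hc : Real.cos φ ≠ 0) (hs : Real.sin φ ≠ 0) (ζ : ℝ)
    [IsFiniteMeasure (twoSided (density₀ φ) (density₁ φ))] :
    charFun (twoSided (density₀ φ) (density₁ φ)) ζ = ∫ y, densityTotal φ y * charKernel ζ y := by
  rw [charFun_twoSided (integrable_density₀ hc hs) (integrable_density₁ hc hs)
    (density₀_nonneg hs) (density₁_nonneg hs)]
  refine integral_congr_ae (Eventually.of_forall fun y => ?_)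
  have e1 : exp (ζ * y * I) = Real.cos (ζ * y) + Real.sin (ζ * y) * I := by
    rw [← ofReal_mul, exp_mul_I, ofReal_cos, ofReal_sin]
  have e2 : exp (-(ζ * y * I)) = Real.cos (ζ * y) - Real.sin (ζ * y) * I := by
    rw [show -(ζ * y * I : ℂ) = ((-(ζ * y) : ℝ) : ℂ) * I by push_cast; ring, exp_mul_I,
      ← ofReal_cos, ← ofReal_sin, Real.cos_neg, Real.sin_neg]
    push_cast; ring
  simp only [e1, e2, density₀_eq hs, density₁_eq hs, charKernel]
  push_cast
  ring

/-- The rescaled law converges weakly. -/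
theorem tendsto_rescaledLaw {ϑ : ℕ → ℝ} (hϑ : ∀ t, ϑ (t + 2) = ϑ t) {φ ψ : ℝ}
    (hφ : Real.cos φ ≠ 0) (hψ : Real.cos ψ ≠ 0) (hφ' : Real.sin φ ≠ 0) (hψ' : Real.sin ψ ≠ 0)
    (h : |Real.cos φ| ≤ |Real.cos ψ|) (he : ϑ 0 = φ ∧ ϑ 1 = ψ ∨ ϑ 0 = ψ ∧ ϑ 1 = φ)
    [hN : IsProbabilityMeasure (twoSided (density₀ φ) (density₁ φ))] :
    Tendsto (β := ProbabilityMeasure ℝ) (fun t => ⟨rescaledLaw ϑ t, inferInstance⟩) atTop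
      (𝓝 ⟨twoSided (density₀ φ) (density₁ φ), hN⟩) := by
  refine ProbabilityMeasure.tendsto_of_tendsto_charFun fun ζ => ?_
  have h0 : Real.cos (ϑ 0) ≠ 0 := by rcases he with ⟨h, _⟩ | ⟨h, _⟩ <;> rwa [h]
  have h1 : Real.cos (ϑ 1) ≠ 0 := by rcases he with ⟨_, h⟩ | ⟨_, h⟩ <;> rwa [h]
  have ha : Real.cos φ * Real.cos ψ = Real.cos (ϑ 0) * Real.cos (ϑ 1) := by
    rcases he with ⟨h, h'⟩ | ⟨h, h'⟩ <;> rw [h, h']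
    exact mul_comm _ _
  have hb : Real.sin φ * Real.sin ψ = Real.sin (ϑ 0) * Real.sin (ϑ 1) := by
    rcases he with ⟨h, h'⟩ | ⟨h, h'⟩ <;> rw [h, h']
    exact mul_comm _ _
  have := tendsto_charFun_rescaledLaw hϑ h0 h1 ζ ha hb
  change Tendsto _ _ (𝓝 (charFun (twoSided (density₀ φ) (density₁ φ)) ζ))
  rw [charFun_limit hφ hφ', ← integral_charKernel_velocity hφ hψ hφ' hψ' h]
  exact this

/-! ### From weak convergence to the half-line walk -/

/-- Sums over lattice points which are close to the probability of an interval converge to the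
limiting distribution function. -/
theorem tendsto_of_staggered {M : ℕ → ProbabilityMeasure ℝ} {N : ProbabilityMeasure ℝ}
    (hM : Tendsto M atTop (𝓝 N)) (hN : (N : Measure ℝ) ≪ volume) {f : ℝ → ℝ} (hf : Integrable f)
    (hNf : ∀ y, 0 ≤ y → (N : Measure ℝ).real (Set.Icc 0 y) = ∫ z in Set.Iic y, f z)
    {x : ℝ} (hx : 0 ≤ x) {F : ℕ → ℝ}
    (hlo : ∀ t, 0 < t → (M t : Measure ℝ).real (Set.Ioc 0 x) ≤ F t)
    (hhi : ∀ t : ℕ, 0 < t → ∀ ε : ℝ, 1 / (t : ℝ) ≤ ε →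
      F t ≤ (M t : Measure ℝ).real (Set.Icc 0 (x + ε))) :
    Tendsto F atTop (𝓝 (∫ z in Set.Iic x, f z)) := by
  have hIoc : (N : Measure ℝ).real (Set.Ioc 0 x) = ∫ z in Set.Iic x, f z := by
    rw [← hNf x hx, measureReal_def, measureReal_def, measure_congr (hN.ae_eq Ioc_ae_eq_Icc)]
  have h1 := tendsto_real_of_convex hM hN (convex_Ioc 0 x)
  rw [hIoc] at h1
  have hcont : Continuous fun y => ∫ z in Set.Iic y, f z := by
    have : (fun y => ∫ z in Set.Iic y, f z)
        = fun y => (∫ z in Set.Iic 0, f z) + ∫ z in (0 : ℝ)..y, f z := by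
      ext y
      rw [← intervalIntegral.integral_Iic_sub_Iic hf.integrableOn hf.integrableOn]; ring
    rw [this]
    exact continuous_const.add
      (intervalIntegral.continuous_primitive (fun a b => hf.intervalIntegrable) 0)
  rw [tendsto_order]
  constructor
  · intro a ha
    filter_upwards [h1.eventually_const_lt ha, eventually_gt_atTop 0] with t ht ht0
    exact ht.trans_le (hlo t ht0)
  · intro a ha
    -- The overshoot `1 / t` is enlarged to a fixed `ε`, so that weak convergence is applied to one
    -- fixed interval.
    have hev : ∀ᶠ ε in 𝓝[>] (0 : ℝ), ∫ z in Set.Iic (x + ε), f z < a := by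
      have : Tendsto (fun ε => ∫ z in Set.Iic (x + ε), f z) (𝓝 0) (𝓝 (∫ z in Set.Iic x, f z)) := by
        have := (hcont.comp (continuous_const_add x)).tendsto 0
        simpa [Function.comp_def] using this
      exact (this.mono_left nhdsWithin_le_nhds).eventually_lt_const ha
    obtain ⟨ε, hε, hε0⟩ := (hev.and self_mem_nhdsWithin).exists
    have hε0 : 0 < ε := hε0
    have h2 := tendsto_real_of_convex hM hN (convex_Icc 0 (x + ε))
    rw [hNf _ (by linarith)] at h2
    filter_upwards [h2.eventually_lt_const hε, eventually_gt_atTop 0,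
      tendsto_one_div_atTop_nhds_zero_nat.eventually_le_const hε0] with t ht ht0 ht1
    exact (hhi t ht0 ε ht1).trans_lt ht

theorem prob_eq_zero_of_lt (θ : Fin 2 → ℝ) (α β : ℂ) {t x : ℕ} (h : t < x) (j : Fin 2) :
    prob θ α β t x j = 0 := by
  simp [prob, state_eq_zero θ α β t x h]

theorem rescaledCdf_of_neg (θ : Fin 2 → ℝ) (α β : ℂ) (t : ℕ) (j : Fin 2) {x : ℝ} (hx : x < 0) :
    rescaledCdf θ α β t j x = 0 := by
  have : IsEmpty {k : ℕ | (k : ℝ) / (t : ℝ) ≤ x} := by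
    refine ⟨fun k => ?_⟩
    have h1 : ((k : ℕ) : ℝ) / (t : ℝ) ≤ x := k.2
    have h2 : 0 ≤ ((k : ℕ) : ℝ) / (t : ℝ) := by positivity
    linarith
  exact tsum_empty

theorem rescaledCdf_eq_sum (θ : Fin 2 → ℝ) (α β : ℂ) {t : ℕ} (ht : 0 < t) (j : Fin 2) {x : ℝ}
    (hx : 0 ≤ x) :
    rescaledCdf θ α β t j x = ∑ k ∈ range (⌊x * t⌋₊ + 1), prob θ α β t k j := by
  have e : {k : ℕ | (k : ℝ) / (t : ℝ) ≤ x} = (range (⌊x * t⌋₊ + 1) : Set ℕ) := by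
    ext k
    have ht' : (0 : ℝ) < t := by exact_mod_cast ht
    simp [div_le_iff₀ ht', Nat.le_floor_iff (show 0 ≤ x * t by positivity)]
  rw [rescaledCdf, e]
  exact Finset.tsum_subtype' (range (⌊x * t⌋₊ + 1)) fun k => prob θ α β t k j

theorem rescaledTotalCdf_eq_add (θ : Fin 2 → ℝ) (α β : ℂ) (t : ℕ) (x : ℝ) :
    rescaledTotalCdf θ α β t x = rescaledCdf θ α β t 0 x + rescaledCdf θ α β t 1 x := by
  have hs : ∀ j, Summable fun k : ℕ => prob θ α β t k j := fun j =>
    summable_of_ne_finset_zero (s := range (t + 1)) fun k hk =>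
      prob_eq_zero_of_lt θ α β (by simpa using hk) j
  simp only [rescaledTotalCdf, totalProb, Fin.sum_univ_two]
  exact ((hs 0).subtype _).tsum_add ((hs 1).subtype _)

open scoped Classical in
/-- Comparison of staggered sums with the measure of an interval. -/
theorem staggered_le_measure {t : ℕ} (ht : 0 < t) {M : Measure ℝ} {w a b : ℤ → ℝ} {f : ℕ → ℝ}
    (hw0 : ∀ x : ℤ, (t : ℤ) < |x| → w x = 0)
    (hM : ∀ s, MeasurableSet s →
      M.real s = ∑ k ∈ (Icc (-t : ℤ) t).filter (fun k : ℤ => (k : ℝ) / t ∈ s), w k)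
    (ha : ∀ x, 0 ≤ a x) (hb : ∀ x, 0 ≤ b x)
    (hw : ∀ x, a x + b x = w x) (hf : ∀ x : ℕ, f x = a x + b (x + 1)) {x : ℝ} (hx : 0 ≤ x) :
    M.real (Set.Ioc 0 x) ≤ ∑ k ∈ range (⌊x * t⌋₊ + 1), f k ∧
      ∀ ε : ℝ, 1 / (t : ℝ) ≤ ε →
        ∑ k ∈ range (⌊x * t⌋₊ + 1), f k ≤ M.real (Set.Icc 0 (x + ε)) := by
  have ht' : (0 : ℝ) < t := by exact_mod_cast ht
  have hwn : ∀ x, 0 ≤ w x := fun x => by rw [← hw]; exact add_nonneg (ha x) (hb x)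
  obtain ⟨h1, h2⟩ := sum_staggered_bounds ha hb hw hf ⌊x * t⌋₊
  have hfl : (⌊x * t⌋₊ : ℤ) = ⌊x * t⌋ := Int.natCast_floor_eq_floor (by positivity)
  constructor
  · rw [hM _ measurableSet_Ioc]
    refine le_trans (Finset.sum_le_sum_of_subset_of_nonneg ?_ fun k _ _ => hwn k) h1
    intro k hk
    simp only [Finset.mem_filter, Set.mem_Ioc, div_le_iff₀ ht', div_pos_iff_of_pos_right ht'] at hk
    rw [Finset.mem_Icc, hfl]
    exact ⟨by exact_mod_cast hk.2.1, Int.le_floor.2 hk.2.2⟩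
  · intro ε hε
    rw [hM _ measurableSet_Icc]
    refine h2.trans ?_
    -- The upper index may exceed `t`; dropping zero terms brings the sum back into the range `-t,
    -- …, t`.
    rw [← Finset.sum_filter_ne_zero]
    refine Finset.sum_le_sum_of_subset_of_nonneg ?_ fun k _ _ => hwn k
    intro k hk
    simp only [Finset.mem_filter, Finset.mem_Icc] at hk ⊢
    obtain ⟨⟨hk0, hk1⟩, hk2⟩ := hk
    have h3 : |k| ≤ t := not_lt.1 fun h => hk2 (hw0 k h)
    refine ⟨abs_le.1 h3, div_nonneg (by exact_mod_cast hk0) ht'.le, ?_⟩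
    rw [div_le_iff₀ ht']
    rw [hfl] at hk1
    have h4 : (k : ℝ) ≤ ⌊x * t⌋ + 1 := by exact_mod_cast hk1
    have h5 := Int.floor_le (x * t)
    rw [div_le_iff₀ ht'] at hε
    linarith

open scoped Classical in
theorem map_neg_rescaledLaw_apply (ϑ : ℕ → ℝ) (t : ℕ) {s : Set ℝ} (hs : MeasurableSet s) :
    ((rescaledLaw ϑ t).map Neg.neg).real s
      = ∑ x ∈ (Icc (-t : ℤ) t).filter (fun x : ℤ => (x : ℝ) / t ∈ s), weight ϑ t (-x) := by
  rw [measureReal_def, Measure.map_apply measurable_neg hs, ← measureReal_def,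
    rescaledLaw_apply _ _ (measurable_neg hs)]
  refine Finset.sum_nbij' (fun x => -x) (fun x => -x) ?_ ?_ (by simp) (by simp) (by simp)
  · intro k hk
    simp only [Finset.mem_filter, Finset.mem_Icc, Set.mem_preimage] at hk ⊢
    refine ⟨by omega, ?_⟩
    rw [Int.cast_neg, neg_div]; exact hk.2
  · intro k hk
    simp only [Finset.mem_filter, Finset.mem_Icc, Set.mem_preimage] at hk ⊢
    refine ⟨by omega, ?_⟩
    rw [Int.cast_neg, neg_div, neg_neg]; exact hk.2

theorem weight_eq_zero_of_lt (ϑ : ℕ → ℝ) (t : ℕ) (x : ℤ) (h : (t : ℤ) < |x|) :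
    weight ϑ t x = 0 := by
  simp [weight, kernel_eq_zero_of_lt ϑ t x h]

theorem sin_ne_zero_and_cos_ne_zero {x : ℝ} (h : x ∈ Set.Ico 0 (2 * Real.pi))
    (h' : x ∉ ({0, Real.pi / 2, Real.pi, 3 * Real.pi / 2} : Set ℝ)) :
    Real.sin x ≠ 0 ∧ Real.cos x ≠ 0 := by
  have hpi := Real.pi_pos
  simp only [Set.mem_insert_iff, Set.mem_singleton_iff, not_or] at h'
  obtain ⟨h0, h1, h2, h3⟩ := h'
  constructor
  · intro hs
    obtain ⟨n, hn⟩ := Real.sin_eq_zero_iff.1 hs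
    have l1 : (-1 : ℝ) < n := by nlinarith [h.1]
    have l2 : (n : ℝ) < 2 := by nlinarith [h.2]
    have l1' : -1 < n := by exact_mod_cast l1
    have l2' : n < 2 := by exact_mod_cast l2
    interval_cases n
    · exact h0 (by rw [← hn]; simp)
    · exact h2 (by rw [← hn]; simp)
  · intro hs
    obtain ⟨n, hn⟩ := Real.cos_eq_zero_iff.1 hs
    have l1 : (-1 : ℝ) < n := by nlinarith [h.1]
    have l2 : (n : ℝ) < 2 := by nlinarith [h.2]
    have l1' : -1 < n := by exact_mod_cast l1
    have l2' : n < 2 := by exact_mod_cast l2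
    interval_cases n
    · exact h1 (by rw [hn]; simp)
    · exact h3 (by rw [hn]; push_cast; ring)

end HalfLineWalk

open HalfLineWalk in
theorem theorem1 (θ : Fin 2 → ℝ)
    (hθ : ∀ i, θ i ∈ Set.Ico 0 (2 * Real.pi))
    (hθ' : ∀ i, θ i ∉ ({0, Real.pi / 2, Real.pi, 3 * Real.pi / 2} : Set ℝ))
    (α β : ℂ) (hαβ : ‖α‖ ^ 2 + ‖β‖ ^ 2 = 1)
    (ξ : Fin 2) (hξ : |Real.cos (θ ξ)| = min |Real.cos (θ 0)| |Real.cos (θ 1)|) :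
    (MeasureTheory.Integrable (HalfLineWalk.density₀ (θ ξ)) MeasureTheory.volume ∧
      MeasureTheory.Integrable (HalfLineWalk.density₁ (θ ξ)) MeasureTheory.volume ∧
      MeasureTheory.Integrable (HalfLineWalk.densityTotal (θ ξ)) MeasureTheory.volume) ∧
    ∀ x : ℝ,
      Filter.Tendsto (fun t : ℕ => HalfLineWalk.rescaledCdf θ α β t 0 x) Filter.atTop
        (nhds (∫ y in Set.Iic x, HalfLineWalk.density₀ (θ ξ) y)) ∧
      Filter.Tendsto (fun t : ℕ => HalfLineWalk.rescaledCdf θ α β t 1 x) Filter.atTop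
        (nhds (∫ y in Set.Iic x, HalfLineWalk.density₁ (θ ξ) y)) ∧
      Filter.Tendsto (fun t : ℕ => HalfLineWalk.rescaledTotalCdf θ α β t x) Filter.atTop
        (nhds (∫ y in Set.Iic x, HalfLineWalk.densityTotal (θ ξ) y)) := by
  have hsin : ∀ i, Real.sin (θ i) ≠ 0 := fun i => (sin_ne_zero_and_cos_ne_zero (hθ i) (hθ' i)).1
  have hcos : ∀ i, Real.cos (θ i) ≠ 0 := fun i => (sin_ne_zero_and_cos_ne_zero (hθ i) (hθ' i)).2
  have hi0 := integrable_density₀ (hcos ξ) (hsin ξ)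
  have hi1 := integrable_density₁ (hcos ξ) (hsin ξ)
  have hn0 := density₀_nonneg (hsin ξ)
  have hn1 := density₁_nonneg (hsin ξ)
  have hz0 : ∀ y < 0, density₀ (θ ξ) y = 0 := fun y hy =>
    Set.indicator_of_notMem (fun h => absurd h.1 (not_le.2 hy)) _
  have hz1 : ∀ y < 0, density₁ (θ ξ) y = 0 := fun y hy =>
    Set.indicator_of_notMem (fun h => absurd h.1 (not_le.2 hy)) _
  refine ⟨⟨hi0, hi1, integrable_densityTotal (hcos ξ) (hsin ξ)⟩, fun x => ?_⟩
  obtain ⟨ψ, hψs, hψc, hle, he⟩ : ∃ ψ, Real.sin ψ ≠ 0 ∧ Real.cos ψ ≠ 0 ∧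
      |Real.cos (θ ξ)| ≤ |Real.cos ψ| ∧ (angles θ 0 = θ ξ ∧ angles θ 1 = ψ ∨
        angles θ 0 = ψ ∧ angles θ 1 = θ ξ) := by
    fin_cases ξ
    · exact ⟨θ 1, hsin 1, hcos 1, hξ.trans_le (min_le_right _ _), Or.inl ⟨rfl, rfl⟩⟩
    · exact ⟨θ 0, hsin 0, hcos 0, hξ.trans_le (min_le_left _ _), Or.inr ⟨rfl, rfl⟩⟩
  have hper : ∀ t, angles θ (t + 2) = angles θ t := fun t => by simp [angles, Nat.even_add]
  have hN : MeasureTheory.IsProbabilityMeasure (twoSided (density₀ (θ ξ)) (density₁ (θ ξ))) := by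
    refine isProbabilityMeasure_twoSided hi0 hi1 hn0 hn1 ?_
    simp_rw [density₀_add_density₁ (hsin ξ)]
    exact integral_densityTotal (hcos ξ) (hsin ξ)
  have hconv := tendsto_rescaledLaw hper (hcos ξ) hψc (hsin ξ) hψs hle he
  -- Inner state 1 lives on the nonpositive sites, so it is governed by the reflected law, whose
  -- limit has the two densities exchanged.
  have hconv' := MeasureTheory.ProbabilityMeasure.tendsto_map_of_tendsto_of_continuous _ _ hconv
    (continuous_neg (G := ℝ))
  have lim0 : Filter.Tendsto (fun t : ℕ => rescaledCdf θ α β t 0 x) Filter.atTop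
      (nhds (∫ y in Set.Iic x, density₀ (θ ξ) y)) := by
    rcases lt_or_ge x 0 with hx | hx
    · simp_rw [rescaledCdf_of_neg θ α β _ 0 hx]
      rw [MeasureTheory.setIntegral_eq_zero_of_forall_eq_zero
        fun y (hy : y ∈ Set.Iic x) => hz0 y (lt_of_le_of_lt hy hx)]
      exact tendsto_const_nhds
    · refine tendsto_of_staggered hconv (twoSided_absolutelyContinuous _ _) hi0
        (fun y hy => twoSided_Icc hi0 hn0 hz0 hz1 hy) hx ?_ ?_
      · intro t ht
        obtain ⟨a, b, ha, hb, hw, hf⟩ := exists_prob_zero_eq θ α β hαβ t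
        rw [rescaledCdf_eq_sum θ α β ht 0 hx]
        exact (staggered_le_measure ht (weight_eq_zero_of_lt _ t)
          (fun s hs => rescaledLaw_apply _ t hs) ha hb hw hf hx).1
      · intro t ht
        obtain ⟨a, b, ha, hb, hw, hf⟩ := exists_prob_zero_eq θ α β hαβ t
        rw [rescaledCdf_eq_sum θ α β ht 0 hx]
        exact (staggered_le_measure ht (weight_eq_zero_of_lt _ t)
          (fun s hs => rescaledLaw_apply _ t hs) ha hb hw hf hx).2
  have lim1 : Filter.Tendsto (fun t : ℕ => rescaledCdf θ α β t 1 x) Filter.atTop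
      (nhds (∫ y in Set.Iic x, density₁ (θ ξ) y)) := by
    rcases lt_or_ge x 0 with hx | hx
    · simp_rw [rescaledCdf_of_neg θ α β _ 1 hx]
      rw [MeasureTheory.setIntegral_eq_zero_of_forall_eq_zero
        fun y (hy : y ∈ Set.Iic x) => hz1 y (lt_of_le_of_lt hy hx)]
      exact tendsto_const_nhds
    · have hw0 : ∀ t : ℕ, ∀ k : ℤ, (t : ℤ) < |k| → weight (angles θ) t (-k) = 0 := fun t k hk =>
        weight_eq_zero_of_lt _ t _ (by rwa [abs_neg])
      have hmap := map_neg_twoSided (density₀ (θ ξ)) (density₁ (θ ξ))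
      refine tendsto_of_staggered hconv' ?_ hi1 ?_ hx ?_ ?_
      · exact hmap.absolutelyContinuous.trans (twoSided_absolutelyContinuous _ _)
      · intro y hy
        exact (congrArg (fun μ : MeasureTheory.Measure ℝ => μ.real (Set.Icc 0 y)) hmap).trans
          (twoSided_Icc hi1 hn1 hz1 hz0 hy)
      · intro t ht
        obtain ⟨a, b, ha, hb, hw, hf⟩ := exists_prob_one_eq θ α β hαβ t
        rw [rescaledCdf_eq_sum θ α β ht 1 hx]
        exact (staggered_le_measure ht (hw0 t)
          (fun s hs => map_neg_rescaledLaw_apply _ t hs) ha hb hw hf hx).1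
      · intro t ht
        obtain ⟨a, b, ha, hb, hw, hf⟩ := exists_prob_one_eq θ α β hαβ t
        rw [rescaledCdf_eq_sum θ α β ht 1 hx]
        exact (staggered_le_measure ht (hw0 t)
          (fun s hs => map_neg_rescaledLaw_apply _ t hs) ha hb hw hf hx).2
  refine ⟨lim0, lim1, ?_⟩
  simp_rw [rescaledTotalCdf_eq_add, ← density₀_add_density₁ (hsin ξ)]
  rw [MeasureTheory.integral_add hi0.integrableOn hi1.integrableOn]
  exact lim0.add lim1
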